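/- A market with $n$ songs is given by a scaling factor $\alpha>0$, appeals $A_i\ge 0$, download counts $D_i\in\mathbb N$, qualities $q_i\in[0,1]$ ($1\le i\le n$) and visibilities $v_p\ge 0$ of the positions $p=1,\dots,n$ (with $v$ not necessarily monotone). For a ranking $\sigma\in S_n$, where $\sigma_i$ is the position of song $i$, song $i$ is sampled with probability $$p_i(\sigma)=\frac{v_{\sigma_i}(\alpha A_i+D_i)}{\sum_{j=1}^n v_{\sigma_j}(\alpha A_j+D_j)},$$ and it is assumed that the denominator is nonzero for every $\sigma\in S_n$. A performance ranking is a permutation $\sigma^*\in S_n$ that maximizes the expected number of downloads $$\sum_{i=1}^n p_i(\sigma)\,q_i=\frac{\sum_{i} v_{\sigma_i}(\alpha A_i+D_i)q_i}{\sum_{i} v_{\sigma_i}(\alpha A_i+D_i)}$$ over all $\sigma\in S_n$. **Theorem.** A performance ranking can be computed in strongly polynomial time from the input $(A_i)_i,(D_i)_i,(q_i)_i,(v_p)_p,\alpha$. Here strongly polynomial time has its usual meaning: there is one program, the same for all $n$ and all markets, for a random access machine that performs the exact operations $+,-,\times,/$ and comparisons on numbers (with rational constants), and additions, truncated subtractions,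 comparisons and indirect addressing on integer variables, each at unit cost, such that 1. on every market with real data the program never divides by zero, halts after a number of steps that is at most a fixed polynomial in the number $4n+1$ of input numbers, independently of their values, and outputs the positions $\sigma^*_1,\dots,\sigma^*_n$ of a performance ranking $\sigma^*$; 2. if all input numbers are rational, then all numbers occurring during the computation are rational, and their binary encoding lengths (as well as those of all integers occurring in it) are at most a fixed polynomial in the total binary encoding length of the input. -/

import Mathlib

/-! ## A random access machine with exact arithmetic

Programs are structured (sequencing, branching, loops), finite, and independent of the input.
A program has finitely many integer variables, arrays of integers and arrays of numbers, which it
can access at an address held in an integer variable.  Every elementary step costs one time unit. -/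

namespace ArithRAM

/-- An address inside an array: a literal, or the current value of an integer variable. -/
inductive Addr
  | lit (k : ℕ)
  | var (x : ℕ)

/-- A memory cell that holds a number: the name of an array and an address in it. -/
structure Cell where
  arr : ℕ
  addr : Addr

/-- The elementary arithmetic operations on numbers. -/
inductive ArithOp
  | add | sub | mul | div

/-- The tests on which a program may branch: comparisons of two numbers or of two integer
variables. -/
inductive Test
  | numLe (c d : Cell)
  | numLt (c d : Cell)
  | intLe (x y : ℕ)
  | intLt (x y : ℕ)

/-- Programs. -/
inductive Cmd
  | skip
  /-- store a rational constant in the cell `d` -/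
  | numConst (d : Cell) (r : ℚ)
  /-- copy the number in `c` to `d` -/
  | numCopy (d c : Cell)
  /-- `d := c₁ op c₂` -/
  | numOp (op : ArithOp) (d c₁ c₂ : Cell)
  /-- `x := k` for integer variables -/
  | intConst (x k : ℕ)
  /-- `x := y` for integer variables -/
  | intCopy (x y : ℕ)
  /-- `x := y + z` for integer variables -/
  | intAdd (x y z : ℕ)
  /-- `x := max (y - z) 0` for integer variables -/
  | intSub (x y z : ℕ)
  /-- `x := a[addr]` where `a` is an integer array -/
  | intLoad (x a : ℕ) (addr : Addr)
  /-- `a[addr] := x` where `a` is an integer array -/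
  | intStore (a : ℕ) (addr : Addr) (x : ℕ)
  | seq (p q : Cmd)
  | ite (b : Test) (p q : Cmd)
  /-- `while b do p` -/
  | loop (b : Test) (p : Cmd)

/-- The memory: integer variables, integer arrays, number arrays. -/
structure State where
  ivar : ℕ → ℕ
  idx : ℕ → ℕ → ℕ
  num : ℕ → ℕ → ℝ

/-- The value of an address. -/
def Addr.eval (s : State) : Addr → ℕ
  | .lit k => k
  | .var x => s.ivar x

namespace State

/-- The number in a cell. -/
def getNum (s : State) (c : Cell) : ℝ := s.num c.arr (c.addr.eval s)

/-- Overwrite the number in a cell. -/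
noncomputable def setNum (s : State) (c : Cell) (r : ℝ) : State :=
  { s with
    num := Function.update s.num c.arr (Function.update (s.num c.arr) (c.addr.eval s) r) }

/-- Overwrite an integer variable. -/
def setVar (s : State) (x k : ℕ) : State :=
  { s with ivar := Function.update s.ivar x k }

/-- Overwrite an entry of an integer array. -/
def setIdx (s : State) (a i k : ℕ) : State :=
  { s with idx := Function.update s.idx a (Function.update (s.idx a) i k) }

end State

/-- The truth value of a test. -/
def Test.Holds (s : State) : Test → Prop
  | .numLe c d => s.getNum c ≤ s.getNum d
  | .numLt c d => s.getNum c < s.getNum d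
  | .intLe x y => s.ivar x ≤ s.ivar y
  | .intLt x y => s.ivar x < s.ivar y

open Classical in
/-- The result of an arithmetic operation; division by zero has no result. -/
noncomputable def ArithOp.eval? : ArithOp → ℝ → ℝ → Option ℝ
  | .add, x, y => some (x + y)
  | .sub, x, y => some (x - y)
  | .mul, x, y => some (x * y)
  | .div, x, y => if y = 0 then none else some (x / y)

/-- A configuration: the commands still to be executed, and the memory. -/
structure Config where
  todo : List Cmd
  state : State

/-- The machine has halted when nothing is left to be executed. -/
def Config.Halted (c : Config) : Prop := c.todo = []

open Classical in
/-- One step of the machine.  A halted configuration does not change any more; a configuration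
about to divide by zero is stuck (it does not change and is not halted). -/
noncomputable def step (c : Config) : Config :=
  match c.todo with
  | [] => c
  | .skip :: k => ⟨k, c.state⟩
  | .numConst d r :: k => ⟨k, c.state.setNum d (r : ℝ)⟩
  | .numCopy d e :: k => ⟨k, c.state.setNum d (c.state.getNum e)⟩
  | .numOp op d e f :: k =>
      match op.eval? (c.state.getNum e) (c.state.getNum f) with
      | some r => ⟨k, c.state.setNum d r⟩
      | none => c
  | .intConst x m :: k => ⟨k, c.state.setVar x m⟩
  | .intCopy x y :: k => ⟨k, c.state.setVar x (c.state.ivar y)⟩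
  | .intAdd x y z :: k => ⟨k, c.state.setVar x (c.state.ivar y + c.state.ivar z)⟩
  | .intSub x y z :: k => ⟨k, c.state.setVar x (c.state.ivar y - c.state.ivar z)⟩
  | .intLoad x a i :: k => ⟨k, c.state.setVar x (c.state.idx a (i.eval c.state))⟩
  | .intStore a i x :: k => ⟨k, c.state.setIdx a (i.eval c.state) (c.state.ivar x)⟩
  | .seq p q :: k => ⟨p :: q :: k, c.state⟩
  | .ite b p q :: k => if b.Holds c.state then ⟨p :: k, c.state⟩ else ⟨q :: k, c.state⟩
  | .loop b p :: k => if b.Holds c.state then ⟨p :: .loop b p :: k, c.state⟩ else ⟨k, c.state⟩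

/-- The input of a program: finitely many finite arrays of numbers. -/
abbrev Input := List (List ℝ)

/-- The number of numbers in an input. -/
def dimension (I : Input) : ℕ := (I.map List.length).sum

/-- The initial memory: number array `a` holds the `a`-th input array and integer variable `a`
holds its length; everything else is zero. -/
def State.ofInput (I : Input) : State where
  ivar a := (I.getD a []).length
  idx _ _ := 0
  num a i := (I.getD a []).getD i 0

/-- The configuration that the program `P` reaches from the input `I` after `t` steps. -/
noncomputable def run (P : Cmd) (I : Input) (t : ℕ) : Config :=
  step^[t] ⟨[P], State.ofInput I⟩

/-- The binary encoding length of a rational number: sign and binary digits of the numerator and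
of the denominator, in lowest terms. -/
def ratLength (r : ℚ) : ℕ := (1 + Nat.size r.num.natAbs) + (1 + Nat.size r.den)

/-- The binary encoding length of a rational input. -/
def encodingLength (J : List (List ℚ)) : ℕ := (J.map fun l => (l.map ratLength).sum).sum

/-- A rational input, read as an input. -/
noncomputable def castInput (J : List (List ℚ)) : Input := J.map fun l => l.map fun r => (r : ℝ)

/-- Every number in the memory is rational of encoding length at most `B`, and every integer
in it has at most `B` binary digits. -/
def State.SizeLe (s : State) (B : ℕ) : Prop :=
  (∀ a i, ∃ r : ℚ, s.num a i = (r : ℝ) ∧ ratLength r ≤ B) ∧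
    (∀ a i, Nat.size (s.idx a i) ≤ B) ∧ ∀ x, Nat.size (s.ivar x) ≤ B

/-- Strongly polynomial time.  A problem has instances `x : ι` with real input `enc x`; a sequence
`out` of natural numbers is an admissible answer when `Sol x out`.  One program has to write an
admissible answer to integer array `0` and halt, for each instance, after a number of steps that
is polynomial in the number of numbers in the input (regardless of their values); and if the input
is rational, then the encoding lengths of all intermediate numbers have to be polynomial in the
encoding length of the input. -/
def ComputableInStronglyPolynomialTime {ι : Type} (enc : ι → Input)
    (Sol : ι → (ℕ → ℕ) → Prop) : Prop :=
  ∃ (P : Cmd) (T S : Polynomial ℕ), ∀ x : ι,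
    ∃ t ≤ T.eval (dimension (enc x)),
      (run P (enc x) t).Halted ∧
      Sol x ((run P (enc x) t).state.idx 0) ∧
      ∀ J : List (List ℚ), enc x = castInput J →
        ∀ t' ≤ t, (run P (enc x) t').state.SizeLe (S.eval (encodingLength J))

end ArithRAM

/-! ## The market -/

namespace MusicLab

/-- A market of `n` songs at some iteration.  Songs and positions are both numbered by `Fin n`,
and a ranking `σ : Equiv.Perm (Fin n)` maps each song to its position. -/
structure Market (n : ℕ) where
  /-- the scaling factor -/
  α : ℝ
  /-- the appeals of the songs -/
  A : Fin n → ℝ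
  /-- the download counts of the songs -/
  D : Fin n → ℕ
  /-- the qualities of the songs -/
  q : Fin n → ℝ
  /-- the visibilities of the positions -/
  v : Fin n → ℝ
  α_pos : 0 < α
  A_nonneg : ∀ i, 0 ≤ A i
  q_nonneg : ∀ i, 0 ≤ q i
  q_le_one : ∀ i, q i ≤ 1
  v_nonneg : ∀ p, 0 ≤ v p
  /-- the sampling probabilities are well defined under every ranking -/
  total_ne_zero : ∀ σ : Equiv.Perm (Fin n), ∑ j, v (σ j) * (α * A j + D j) ≠ 0

namespace Market

variable {n : ℕ}

/-- The probability of sampling song `i` under the ranking `σ`. -/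
noncomputable def samplingProb (M : Market n) (σ : Equiv.Perm (Fin n)) (i : Fin n) : ℝ :=
  M.v (σ i) * (M.α * M.A i + M.D i) / ∑ j, M.v (σ j) * (M.α * M.A j + M.D j)

/-- The expected number of downloads under the ranking `σ`. -/
noncomputable def expectedDownloads (M : Market n) (σ : Equiv.Perm (Fin n)) : ℝ :=
  ∑ i, M.samplingProb σ i * M.q i

/-- `σ` maximizes the expected number of downloads over all rankings. -/
def IsPerformanceRanking (M : Market n) (σ : Equiv.Perm (Fin n)) : Prop :=
  ∀ τ : Equiv.Perm (Fin n), M.expectedDownloads τ ≤ M.expectedDownloads σ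

/-- The market data as an input: appeals, download counts, qualities, visibilities, and the
scaling factor. -/
noncomputable def input (M : Market n) : ArithRAM.Input :=
  [List.ofFn M.A, List.ofFn fun i => (M.D i : ℝ), List.ofFn M.q, List.ofFn M.v, [M.α]]

end Market

end MusicLab

/-! The proof is a parametric argument from fractional programming. Put a_i = αA_i + D_i and w_i =
a_i q_i. If a ranking τ has value r, then ∑ v_{τ_i}(w_i − r a_i) = 0, so any ranking that maximizes
this linear objective has value at least r. By the rearrangement inequality, a maximizer matches the
songs, sorted by the key w_i − r a_i, with the positions, sorted by visibility. The order of the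
keys changes only at breakpoints (w_i − w_j)/(a_i − a_j). If μ is the largest breakpoint not
exceeding r, the order at μ, with ties won by the smaller a_i, is still correct at r
(`le_of_precedes`). Hence the rankings at the breakpoints of the n² pairs, 0 included so that some
breakpoint lies below every r ≥ 0, contain an optimal one (`exists_breakpoint_le`).

The program tries them all. It sorts by counting predecessors, in O(n²) steps, which gives O(n⁴) in
total. Every number it forms arises from the input by boundedly many operations, or is a sum of at
most n such numbers, or a quotient of two such sums; so encoding lengths stay polynomial.

For the machine, a `BigStep` derivation records the running time together with an invariant of all
intermediate memories. `Runs` turns this into a program logic whose invariant `State.Bounded`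
carries the size bounds; `Runs.forLoop` is its main rule. -/

namespace ArithRAM

/-! ### Frames -/

/-- The integer variables that a program may write. -/
def Cmd.varsWritten : Cmd → List ℕ
  | .intConst x _ | .intCopy x _ | .intAdd x _ _ | .intSub x _ _ | .intLoad x _ _ => [x]
  | .seq p q | .ite _ p q => p.varsWritten ++ q.varsWritten
  | .loop _ p => p.varsWritten
  | _ => []

/-- The integer arrays that a program may write. -/
def Cmd.idxsWritten : Cmd → List ℕ
  | .intStore a _ _ => [a]
  | .seq p q | .ite _ p q => p.idxsWritten ++ q.idxsWritten
  | .loop _ p => p.idxsWritten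
  | _ => []

/-- The number arrays that a program may write. -/
def Cmd.numsWritten : Cmd → List ℕ
  | .numConst d _ | .numCopy d _ | .numOp _ d _ _ => [d.arr]
  | .seq p q | .ite _ p q => p.numsWritten ++ q.numsWritten
  | .loop _ p => p.numsWritten
  | _ => []

/-- Two states agree on everything that the program `c` does not write. -/
structure AgreeOff (c : Cmd) (s s' : State) : Prop where
  ivar : ∀ x, x ∉ c.varsWritten → s'.ivar x = s.ivar x
  idx : ∀ a, a ∉ c.idxsWritten → s'.idx a = s.idx a
  num : ∀ a, a ∉ c.numsWritten → s'.num a = s.num a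

namespace AgreeOff

theorem refl (c : Cmd) (s : State) : AgreeOff c s s :=
  ⟨fun _ _ => rfl, fun _ _ => rfl, fun _ _ => rfl⟩

theorem trans {c : Cmd} {s s' s'' : State} (h : AgreeOff c s s') (h' : AgreeOff c s' s'') :
    AgreeOff c s s'' :=
  ⟨fun x hx => (h'.ivar x hx).trans (h.ivar x hx), fun a ha => (h'.idx a ha).trans (h.idx a ha),
    fun a ha => (h'.num a ha).trans (h.num a ha)⟩

theorem mono {c d : Cmd} {s s' : State} (h : AgreeOff c s s')
    (hv : c.varsWritten ⊆ d.varsWritten) (hi : c.idxsWritten ⊆ d.idxsWritten)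
    (hn : c.numsWritten ⊆ d.numsWritten) : AgreeOff d s s' :=
  ⟨fun x hx => h.ivar x fun h => hx (hv h), fun a ha => h.idx a fun h => ha (hi h),
    fun a ha => h.num a fun h => ha (hn h)⟩

/-- The equation forces one step to consume `c` entirely. This excludes `seq`, `ite`, an entered
loop and a stuck division, so a loop whose test fails is the only composite case. -/
theorem of_step {c : Cmd} {s s' : State} (h : ∀ k, step ⟨c :: k, s⟩ = ⟨k, s'⟩) :
    AgreeOff c s s' := by
  have h := h []
  cases c with
  | numOp op d e f =>
    simp only [step] at h
    split at h
    · simp only [Config.mk.injEq, true_and] at h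
      subst h
      refine ⟨fun _ _ => rfl, fun _ _ => rfl, fun a ha => ?_⟩
      simp only [Cmd.numsWritten, List.mem_singleton] at ha
      simp [State.setNum, Function.update_of_ne ha]
    · simp at h
  | seq p q => simp [step] at h
  | ite b p q =>
    simp only [step] at h
    split at h <;> simp at h
  | loop b p =>
    simp only [step] at h
    split at h
    · simp at h
    · simp only [Config.mk.injEq, true_and] at h
      subst h
      exact refl _ _
  | _ =>
    simp only [step, Config.mk.injEq, true_and] at h
    subst h
    refine ⟨fun x hx => ?_, fun x hx => ?_, fun x hx => ?_⟩ <;>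
      simp_all [State.setNum, State.setVar, State.setIdx, Cmd.varsWritten, Cmd.idxsWritten,
        Cmd.numsWritten]

end AgreeOff

/-! ### Big-step semantics -/

/-- `BigStep I c s t s'`: started in the state `s`, the program `c` terminates in the state `s'`
after `t` steps, and all states after the first satisfy `I`. -/
inductive BigStep (I : State → Prop) : Cmd → State → ℕ → State → Prop
  -- Besides the elementary commands this covers leaving a loop whose test fails.
  | prim {c s s'} (h : ∀ k, step ⟨c :: k, s⟩ = ⟨k, s'⟩) (hI : I s') : BigStep I c s 1 s'
  | seq {p q s t s' t' s''} (hp : BigStep I p s t s') (hq : BigStep I q s' t' s'') :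
      BigStep I (.seq p q) s (t' + t + 1) s''
  | ite_true {b p q s t s'} (hb : b.Holds s) (hp : BigStep I p s t s') :
      BigStep I (.ite b p q) s (t + 1) s'
  | ite_false {b p q s t s'} (hb : ¬ b.Holds s) (hq : BigStep I q s t s') :
      BigStep I (.ite b p q) s (t + 1) s'
  | loop {b p s t s' t' s''} (hb : b.Holds s) (hp : BigStep I p s t s')
      (hl : BigStep I (.loop b p) s' t' s'') : BigStep I (.loop b p) s (t' + t + 1) s''

namespace BigStep

variable {I : State → Prop} {c : Cmd} {s s' : State} {t : ℕ}

theorem agreeOff (h : BigStep I c s t s') : AgreeOff c s s' := by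
  induction h with
  | prim h _ => exact .of_step h
  | seq _ _ ihp ihq =>
    exact (ihp.mono (by simp [Cmd.varsWritten]) (by simp [Cmd.idxsWritten])
      (by simp [Cmd.numsWritten])).trans (ihq.mono (by simp [Cmd.varsWritten])
      (by simp [Cmd.idxsWritten]) (by simp [Cmd.numsWritten]))
  | ite_true _ _ ih =>
    exact ih.mono (by simp [Cmd.varsWritten]) (by simp [Cmd.idxsWritten])
      (by simp [Cmd.numsWritten])
  | ite_false _ _ ih =>
    exact ih.mono (by simp [Cmd.varsWritten]) (by simp [Cmd.idxsWritten])
      (by simp [Cmd.numsWritten])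
  | loop _ _ _ ihp ihl =>
    exact (ihp.mono (by simp [Cmd.varsWritten]) (by simp [Cmd.idxsWritten])
      (by simp [Cmd.numsWritten])).trans ihl

theorem invariant (h : BigStep I c s t s') : I s' := by
  induction h <;> assumption

theorem iterate_step (h : BigStep I c s t s') (k : List Cmd) :
    step^[t] ⟨c :: k, s⟩ = ⟨k, s'⟩ := by
  induction h generalizing k with
  | prim h _ => exact h k
  | seq _ _ ihp ihq =>
    rw [Function.iterate_succ_apply, Function.iterate_add_apply]
    simp [step, ihp, ihq]
  | ite_true hb _ ih | ite_false hb _ ih =>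
    rw [Function.iterate_succ_apply]
    simp [step, hb, ih]
  | loop hb _ _ ihp ihl =>
    rw [Function.iterate_succ_apply, Function.iterate_add_apply]
    simp [step, hb, ihp, ihl]

/-- The size condition concerns every memory along the run, so the invariant is needed at each time
`t'`, not only at the end. -/
theorem invariant_iterate (h : BigStep I c s t s') (hs : I s) (k : List Cmd) {t' : ℕ}
    (ht : t' ≤ t) : I (step^[t'] ⟨c :: k, s⟩).state := by
  induction h generalizing k t' with
  | prim h hI =>
    interval_cases t'
    · exact hs
    · simpa [h] using hI
  | @seq p q s t₁ s₁ t₂ s₂ hp hq ihp ihq =>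
    rcases t' with _ | t'
    · exact hs
    rw [Function.iterate_succ_apply]
    -- Time `t'` falls either into the run of `p` or, `t₁` steps later, into that of `q`.
    rcases le_total t' t₁ with h | h
    · exact ihp hs (q :: k) h
    · obtain ⟨r, rfl⟩ := Nat.exists_eq_add_of_le' h
      rw [Function.iterate_add_apply]
      have e : step ⟨.seq p q :: k, s⟩ = ⟨p :: q :: k, s⟩ := rfl
      rw [e, hp.iterate_step]
      exact ihq hp.invariant k (by omega)
  | ite_true hb hp ih | ite_false hb hp ih =>
    rcases t' with _ | t'
    · exact hs
    rw [Function.iterate_succ_apply]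
    simp only [step, hb, if_true, if_false]
    exact ih hs k (by omega)
  | @loop b p s t₁ s₁ t₂ s₂ hb hp hl ihp ihl =>
    rcases t' with _ | t'
    · exact hs
    rw [Function.iterate_succ_apply]
    have e : step ⟨.loop b p :: k, s⟩ = ⟨p :: .loop b p :: k, s⟩ := by simp [step, hb]
    rw [e]
    rcases le_total t' t₁ with h | h
    · exact ihp hs _ h
    · obtain ⟨r, rfl⟩ := Nat.exists_eq_add_of_le' h
      rw [Function.iterate_add_apply, hp.iterate_step]
      exact ihl hp.invariant k (by omega)

end BigStep

/-! ### Bounded memory and a program logic -/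

/-- The numbers in array `a` satisfy `G a`, and all integers are at most `N`. -/
structure State.Bounded (G : ℕ → ℝ → Prop) (N : ℕ) (s : State) : Prop where
  num : ∀ a i, G a (s.num a i)
  idx : ∀ a i, s.idx a i ≤ N
  ivar : ∀ x, s.ivar x ≤ N

namespace State

@[simp] theorem setVar_num (s : State) (x k : ℕ) : (s.setVar x k).num = s.num := rfl
@[simp] theorem setVar_idx (s : State) (x k : ℕ) : (s.setVar x k).idx = s.idx := rfl
@[simp] theorem setVar_ivar (s : State) (x k y : ℕ) :
    (s.setVar x k).ivar y = if y = x then k else s.ivar y := by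
  simp [setVar, Function.update_apply]

@[simp] theorem setIdx_num (s : State) (a i k : ℕ) : (s.setIdx a i k).num = s.num := rfl
@[simp] theorem setIdx_ivar (s : State) (a i k : ℕ) : (s.setIdx a i k).ivar = s.ivar := rfl
@[simp] theorem setIdx_idx (s : State) (a i k b j : ℕ) :
    (s.setIdx a i k).idx b j = if b = a ∧ j = i then k else s.idx b j := by
  by_cases h : b = a
  · subst h; simp [setIdx, Function.update_apply]
  · simp [setIdx, h]

@[simp] theorem setNum_idx (s : State) (c : Cell) (r : ℝ) : (s.setNum c r).idx = s.idx := rfl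
@[simp] theorem setNum_ivar (s : State) (c : Cell) (r : ℝ) : (s.setNum c r).ivar = s.ivar := rfl
@[simp] theorem setNum_num (s : State) (c : Cell) (r : ℝ) (b j : ℕ) :
    (s.setNum c r).num b j = if b = c.arr ∧ j = c.addr.eval s then r else s.num b j := by
  by_cases h : b = c.arr
  · subst h; simp [setNum, Function.update_apply]
  · simp [setNum, h]

variable {G : ℕ → ℝ → Prop} {N : ℕ} {s : State}

theorem Bounded.setVar (h : s.Bounded G N) {x k : ℕ} (hk : k ≤ N) :
    (s.setVar x k).Bounded G N :=
  ⟨h.num, h.idx, fun y => by rw [setVar_ivar]; split_ifs; exacts [hk, h.ivar y]⟩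

theorem Bounded.setIdx (h : s.Bounded G N) {a i k : ℕ} (hk : k ≤ N) :
    (s.setIdx a i k).Bounded G N :=
  ⟨h.num, fun b j => by rw [setIdx_idx]; split_ifs; exacts [hk, h.idx b j], h.ivar⟩

theorem Bounded.setNum (h : s.Bounded G N) {c : Cell} {r : ℝ} (hr : G c.arr r) :
    (s.setNum c r).Bounded G N :=
  ⟨fun b j => by
    rw [setNum_num]; split_ifs with hb; exacts [hb.1 ▸ hr, h.num b j], h.idx, h.ivar⟩

end State

/-- Started in `s`, if `s` is bounded, the program `c` terminates within `T` steps in a state that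
satisfies `post`, and the memory stays bounded. -/
def Runs (G : ℕ → ℝ → Prop) (N : ℕ) (c : Cmd) (s : State) (T : ℕ) (post : State → Prop) : Prop :=
  s.Bounded G N → ∃ t ≤ T, ∃ s', BigStep (State.Bounded G N) c s t s' ∧ post s'

namespace Runs

variable {G : ℕ → ℝ → Prop} {N : ℕ} {c p q : Cmd} {s : State} {T T' : ℕ} {post post' : State → Prop}

theorem of_bounded (h : s.Bounded G N → Runs G N c s T post) : Runs G N c s T post :=
  fun hs => h hs hs

theorem mono (h : Runs G N c s T post) (hT : T ≤ T') (hp : ∀ s', post s' → post' s') :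
    Runs G N c s T' post' := fun hs =>
  let ⟨t, ht, s', hb, hs'⟩ := h hs
  ⟨t, ht.trans hT, s', hb, hp _ hs'⟩

/-- The frame and the memory bound are handed to the continuation, so a postcondition has to record
only what its program computes. -/
theorem consequence (h : Runs G N c s T post) (hT : T ≤ T')
    (hp : ∀ s', AgreeOff c s s' → s'.Bounded G N → post s' → post' s') :
    Runs G N c s T' post' := fun hs =>
  let ⟨t, ht, s', hb, hs'⟩ := h hs
  ⟨t, ht.trans hT, s', hb, hp _ hb.agreeOff hb.invariant hs'⟩

theorem seq (h : Runs G N p s T fun s' => Runs G N q s' T' post) :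
    Runs G N (.seq p q) s (T' + T + 1) post := fun hs =>
  let ⟨t, ht, _, hb, h'⟩ := h hs
  let ⟨t', ht', s'', hb', h''⟩ := h' hb.invariant
  ⟨t' + t + 1, by omega, s'', hb.seq hb', h''⟩

theorem ite {b : Test} (hp : b.Holds s → Runs G N p s T post)
    (hq : ¬ b.Holds s → Runs G N q s T' post) :
    Runs G N (.ite b p q) s (max T T' + 1) post := fun hs => by
  by_cases hb : b.Holds s
  · obtain ⟨t, ht, s', hs', h⟩ := hp hb hs
    exact ⟨t + 1, by omega, s', .ite_true hb hs', h⟩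
  · obtain ⟨t, ht, s', hs', h⟩ := hq hb hs
    exact ⟨t + 1, by omega, s', .ite_false hb hs', h⟩

theorem prim {s' : State} (h : ∀ k, step ⟨c :: k, s⟩ = ⟨k, s'⟩)
    (hs' : s.Bounded G N → s'.Bounded G N) (hp : post s') : Runs G N c s 1 post :=
  fun hs => ⟨1, le_rfl, s', .prim h (hs' hs), hp⟩

theorem skip (hp : post s) : Runs G N .skip s 1 post :=
  .prim (fun _ => rfl) id hp

theorem numConst {d : Cell} {r : ℚ} (hr : G d.arr r) (hp : post (s.setNum d r)) :
    Runs G N (.numConst d r) s 1 post :=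
  .prim (fun _ => rfl) (·.setNum hr) hp

theorem numCopy {d e : Cell} (hr : G e.arr (s.getNum e) → G d.arr (s.getNum e))
    (hp : post (s.setNum d (s.getNum e))) : Runs G N (.numCopy d e) s 1 post :=
  .prim (fun _ => rfl) (fun h => h.setNum (hr (h.num _ _))) hp

theorem numOp {op : ArithOp} {d e f : Cell} {r : ℝ}
    (h : op.eval? (s.getNum e) (s.getNum f) = some r)
    (hr : G e.arr (s.getNum e) → G f.arr (s.getNum f) → G d.arr r)
    (hp : post (s.setNum d r)) : Runs G N (.numOp op d e f) s 1 post :=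
  .prim (fun _ => by simp [step, h]) (fun hs => hs.setNum (hr (hs.num _ _) (hs.num _ _))) hp

theorem intConst {x k : ℕ} (hk : k ≤ N) (hp : post (s.setVar x k)) :
    Runs G N (.intConst x k) s 1 post :=
  .prim (fun _ => rfl) (·.setVar hk) hp

theorem intAdd {x y z : ℕ} (hk : s.ivar y + s.ivar z ≤ N)
    (hp : post (s.setVar x (s.ivar y + s.ivar z))) : Runs G N (.intAdd x y z) s 1 post :=
  .prim (fun _ => rfl) (·.setVar hk) hp

theorem intLoad {x a : ℕ} {i : Addr} (hp : post (s.setVar x (s.idx a (i.eval s)))) :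
    Runs G N (.intLoad x a i) s 1 post :=
  .prim (fun _ => rfl) (fun h => h.setVar (h.idx _ _)) hp

theorem intStore {x a : ℕ} {i : Addr} (hp : post (s.setIdx a (i.eval s) (s.ivar x))) :
    Runs G N (.intStore a i x) s 1 post :=
  .prim (fun _ => rfl) (fun h => h.setIdx (h.ivar _)) hp

end Runs

/-- `for x in [0, bound) do body`, where the integer variable `one` holds `1`. -/
def Cmd.forLoop (one bound x : ℕ) (body : Cmd) : Cmd :=
  .seq (.intConst x 0) (.loop (.intLt x bound) (.seq body (.intAdd x x one)))

theorem Cmd.varsWritten_forLoop (one bound x : ℕ) (body : Cmd) :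
    (forLoop one bound x body).varsWritten = x :: (body.varsWritten ++ [x]) := rfl

theorem Cmd.idxsWritten_forLoop (one bound x : ℕ) (body : Cmd) :
    (forLoop one bound x body).idxsWritten = body.idxsWritten := by
  simp [forLoop, idxsWritten]

theorem Cmd.numsWritten_forLoop (one bound x : ℕ) (body : Cmd) :
    (forLoop one bound x body).numsWritten = body.numsWritten := by
  simp [forLoop, numsWritten]

/-- A round costs `T + 3`: the loop test, the unfolding of `seq`, the body and the increment. The
counter ends at the value of `bound`, hence respects the bound `N` on integers. `hInv` is needed
because the increment comes after the body has established the invariant. -/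
theorem Runs.forLoop {G : ℕ → ℝ → Prop} {N one bound x n T : ℕ} {body : Cmd} {s : State}
    (Inv : ℕ → State → Prop) (hn : s.ivar bound = n) (h1 : s.ivar one = 1)
    (hxb : bound ≠ x) (hx1 : one ≠ x) (hx : x ∉ body.varsWritten)
    (hb : bound ∉ body.varsWritten) (ho : one ∉ body.varsWritten)
    (hInv : ∀ i s k, Inv i s → Inv i (s.setVar x k))
    (h0 : Inv 0 s)
    (hbody : ∀ i < n, ∀ s', AgreeOff (.forLoop one bound x body) s s' → s'.ivar x = i →
      Inv i s' → Runs G N body s' T (Inv (i + 1))) :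
    Runs G N (.forLoop one bound x body) s (n * (T + 3) + 3) (Inv n) := by
  intro hs
  have hnN : n ≤ N := hn ▸ hs.ivar bound
  have key : ∀ d i s', i + d = n → s'.Bounded G N → AgreeOff (.forLoop one bound x body) s s' →
      s'.ivar x = i → Inv i s' → ∃ t ≤ d * (T + 3) + 1, ∃ s'',
        BigStep (State.Bounded G N) (.loop (.intLt x bound) (.seq body (.intAdd x x one))) s' t s''
          ∧ Inv n s'' := by
    -- Induction on the number `d` of rounds still to be made.
    intro d
    induction d with
    | zero =>
      intro i s' hi hs' hag hxi hI
      have hbv : s'.ivar bound = n := by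
        rw [hag.ivar bound (by simp [Cmd.varsWritten_forLoop, hxb, hb]), hn]
      refine ⟨1, by omega, s', .prim (fun k => ?_) hs', by simpa [← hi] using hI⟩
      have hb' : ¬ (Test.intLt x bound).Holds s' := by simp only [Test.Holds]; omega
      simp only [step, if_neg hb']
    | succ d ih =>
      intro i s' hi hs' hag hxi hI
      have hbv : s'.ivar bound = n := by
        rw [hag.ivar bound (by simp [Cmd.varsWritten_forLoop, hxb, hb]), hn]
      obtain ⟨t, ht, s₁, hb₁, hI₁⟩ := hbody i (by omega) s' hag hxi hI hs'
      have ha := hb₁.agreeOff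
      have hx₁ : s₁.ivar x = i := (ha.ivar x hx).trans hxi
      have ho₁ : s₁.ivar one = 1 := by
        rw [ha.ivar one ho, hag.ivar one (by simp [Cmd.varsWritten_forLoop, hx1, ho]), h1]
      have hinc : BigStep (State.Bounded G N) (.intAdd x x one) s₁ 1 (s₁.setVar x (i + 1)) :=
        .prim (fun k => by simp [step, hx₁, ho₁]) (hb₁.invariant.setVar (by omega))
      have hseq := hb₁.seq hinc
      obtain ⟨t', ht', s₂, hb₂, hI₂⟩ := ih (i + 1) _ (by omega) hseq.invariant
        (hag.trans (hseq.agreeOff.mono (by simp [Cmd.varsWritten_forLoop, Cmd.varsWritten])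
          (by simp [Cmd.idxsWritten_forLoop, Cmd.idxsWritten])
          (by simp [Cmd.numsWritten_forLoop, Cmd.numsWritten])))
        (by simp) (hInv _ _ _ hI₁)
      refine ⟨_, ?_, s₂, .loop (by simp only [Test.Holds]; omega) hseq hb₂, hI₂⟩
      have : (d + 1) * (T + 3) = d * (T + 3) + (T + 3) := by ring
      omega
  have hinit : BigStep (State.Bounded G N) (.intConst x 0) s 1 (s.setVar x 0) :=
    .prim (fun k => rfl) (hs.setVar (by omega))
  obtain ⟨t, ht, s', hb', hI'⟩ := key n 0 _ (by omega) hinit.invariant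
    (hinit.agreeOff.mono (by simp [Cmd.varsWritten_forLoop, Cmd.varsWritten])
      (by simp [Cmd.idxsWritten]) (by simp [Cmd.numsWritten])) (by simp) (hInv _ _ _ h0)
  exact ⟨_, by omega, s', hinit.seq hb', hI'⟩

end ArithRAM

namespace ArithRAM

/-! ### Encoding lengths -/

/-- `x` is a quotient of integers whose absolute values are at most `2 ^ b`. -/
def HasBits (b : ℕ) (x : ℝ) : Prop :=
  ∃ (p : ℤ) (d : ℕ), 0 < d ∧ x = p / d ∧ |p| ≤ 2 ^ b ∧ d ≤ 2 ^ b

namespace HasBits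

variable {a b c : ℕ} {x y : ℝ}

theorem mono (h : HasBits a x) (hab : a ≤ b) : HasBits b x := by
  obtain ⟨p, d, hd, rfl, hp, hd'⟩ := h
  exact ⟨p, d, hd, rfl, hp.trans (pow_le_pow_right₀ (by norm_num) hab),
    hd'.trans (Nat.pow_le_pow_right (by norm_num) hab)⟩

theorem zero : HasBits b 0 := ⟨0, 1, by simp, by simp, by simp, Nat.one_le_two_pow⟩

/-- Fractions need not be reduced, so the usual formula gives the bound directly; the extra bit is
for adding two products. -/
theorem add (hx : HasBits a x) (hy : HasBits b y) (h : a + b + 1 ≤ c) : HasBits c (x + y) := by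
  obtain ⟨p, d, hd, rfl, hp, hd'⟩ := hx
  obtain ⟨p', e, he, rfl, hp', he'⟩ := hy
  have hd0 : (d : ℝ) ≠ 0 := by positivity
  have he0 : (e : ℝ) ≠ 0 := by positivity
  refine mono (a := a + b + 1) ⟨p * e + p' * d, d * e, by positivity, ?_, ?_, ?_⟩ h
  · push_cast; field_simp
  · have hd'' : |(d : ℤ)| ≤ 2 ^ a := by rw [abs_of_nonneg (by positivity)]; exact_mod_cast hd'
    have he'' : |(e : ℤ)| ≤ 2 ^ b := by rw [abs_of_nonneg (by positivity)]; exact_mod_cast he'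
    calc |p * e + p' * d| ≤ |p| * |(e : ℤ)| + |p'| * |(d : ℤ)| := by
          rw [← abs_mul, ← abs_mul]; exact abs_add_le _ _
      _ ≤ 2 ^ a * 2 ^ b + 2 ^ b * 2 ^ a := by gcongr
      _ = 2 ^ (a + b + 1) := by ring
  · calc d * e ≤ 2 ^ a * 2 ^ b := by gcongr
      _ ≤ 2 ^ (a + b + 1) := by rw [← pow_add]; exact Nat.pow_le_pow_right (by norm_num) (by omega)

theorem neg (hx : HasBits a x) : HasBits a (-x) := by
  obtain ⟨p, d, hd, rfl, hp, hd'⟩ := hx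
  exact ⟨-p, d, hd, by push_cast; ring, by simpa using hp, hd'⟩

theorem sub (hx : HasBits a x) (hy : HasBits b y) (h : a + b + 1 ≤ c) : HasBits c (x - y) := by
  rw [sub_eq_add_neg]; exact hx.add hy.neg h

theorem mul (hx : HasBits a x) (hy : HasBits b y) (h : a + b ≤ c) : HasBits c (x * y) := by
  obtain ⟨p, d, hd, rfl, hp, hd'⟩ := hx
  obtain ⟨p', e, he, rfl, hp', he'⟩ := hy
  refine mono (a := a + b) ⟨p * p', d * e, by positivity, ?_, ?_, ?_⟩ h
  · push_cast; field_simp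
  · rw [abs_mul, pow_add]; gcongr
  · rw [pow_add]; gcongr

theorem inv (hx : HasBits a x) : HasBits a x⁻¹ := by
  obtain ⟨p, d, hd, rfl, hp, hd'⟩ := hx
  rcases lt_trichotomy p 0 with h | rfl | h
  -- The denominator has to be positive, so the sign moves to the numerator; for `p = 0` the inverse
  -- is 0 by convention.
  · refine ⟨-d, p.natAbs, by omega, ?_, by simpa using (by exact_mod_cast hd'), by zify; exact hp⟩
    have : ((p.natAbs : ℕ) : ℝ) = -p := by
      rw [Nat.cast_natAbs, abs_of_neg h]; push_cast; rfl
    rw [this, inv_div]; push_cast; rw [neg_div_neg_eq]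
  · simpa using zero
  · refine ⟨d, p.natAbs, by omega, ?_, by simpa using (by exact_mod_cast hd'), by zify; exact hp⟩
    have : ((p.natAbs : ℕ) : ℝ) = p := by
      rw [Nat.cast_natAbs, abs_of_pos h]
    rw [this, inv_div]; push_cast; rfl

theorem div (hx : HasBits a x) (hy : HasBits b y) (h : a + b ≤ c) : HasBits c (x / y) := by
  rw [div_eq_mul_inv]; exact hx.mul hy.inv h

/-- Reducing to lowest terms replaces numerator and denominator by divisors, which are no larger.
Each has at most `b + 1` digits, since `2 ^ b` itself is allowed, and `ratLength` adds one to each.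
-/
theorem exists_ratLength_le (hx : HasBits b x) :
    ∃ r : ℚ, x = (r : ℝ) ∧ ratLength r ≤ 2 * b + 4 := by
  obtain ⟨p, d, hd, rfl, hp, hd'⟩ := hx
  refine ⟨(p : ℚ) / (d : ℚ), by push_cast; rfl, ?_⟩
  have hnum : ((p : ℚ) / (d : ℚ)).num.natAbs ≤ 2 ^ b := by
    have h1 : ((p : ℚ) / ((d : ℤ) : ℚ)).num ∣ p := by
      rw [← Rat.divInt_eq_div]; exact Rat.num_dvd p (by omega)
    rw [Int.cast_natCast] at h1
    rcases eq_or_ne p 0 with rfl | hp0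
    · simp
    · have := Nat.le_of_dvd (by omega) (Int.natAbs_dvd_natAbs.2 h1)
      zify
      zify at this
      exact this.trans hp
  have hden : ((p : ℚ) / (d : ℚ)).den ≤ 2 ^ b := by
    have h1 : ((((p : ℚ) / ((d : ℤ) : ℚ)).den : ℕ) : ℤ) ∣ d := by
      rw [← Rat.divInt_eq_div]; exact Rat.den_dvd p d
    rw [Int.cast_natCast] at h1
    exact (Nat.le_of_dvd hd (by exact_mod_cast h1)).trans hd'
  have hsize : ∀ m : ℕ, m ≤ 2 ^ b → m.size ≤ b + 1 := fun m hm =>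
    Nat.size_le.2 (hm.trans_lt (Nat.pow_lt_pow_right (by norm_num) (by omega)))
  have := hsize _ hnum
  have := hsize _ hden
  unfold ratLength
  omega

theorem of_ratLength_le {r : ℚ} (h : ratLength r ≤ b) : HasBits b (r : ℝ) := by
  unfold ratLength at h
  refine ⟨r.num, r.den, r.pos, by exact_mod_cast (Rat.num_div_den r).symm, ?_, ?_⟩
  · have : r.num.natAbs < 2 ^ b := Nat.size_le.1 (by omega)
    rw [Int.abs_eq_natAbs]; exact_mod_cast this.le
  · exact (Nat.size_le.1 (by omega : r.den.size ≤ b)).le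

end HasBits

theorem ratLength_le_encodingLength {J : List (List ℚ)} {l : List ℚ} {r : ℚ} (hl : l ∈ J)
    (hr : r ∈ l) : ratLength r ≤ encodingLength J :=
  (List.single_le_sum (by simp) _ (List.mem_map_of_mem hr)).trans
    (List.single_le_sum (by simp) _ (List.mem_map_of_mem (f := fun l => (l.map ratLength).sum) hl))

theorem castInput_eq_map (J : List (List ℚ)) :
    castInput J = J.map (List.map ((↑) : ℚ → ℝ)) := by
  refine congrFun (congrArg List.map (funext fun l => ?_)) J
  induction l with
  | nil => rfl
  | cons r l ih => simpa using ih

theorem hasBits_ofInput (J : List (List ℚ)) (a i : ℕ) :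
    HasBits (encodingLength J) ((State.ofInput (castInput J)).num a i) := by
  simp only [State.ofInput, castInput_eq_map, List.getD_eq_getElem?_getD, List.getElem?_map]
  rcases h : J[a]? with _ | l
  · simpa using HasBits.zero
  · simp only [Option.map_some, Option.getD_some, List.getElem?_map]
    rcases h' : l[i]? with _ | r
    · simpa using HasBits.zero
    · exact .of_ratLength_le
        (ratLength_le_encodingLength (List.mem_of_getElem? h) (List.mem_of_getElem? h'))

theorem dimension_castInput_le (J : List (List ℚ)) :
    dimension (castInput J) ≤ encodingLength J := by
  simp only [dimension, castInput_eq_map, encodingLength, List.map_map]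
  refine List.sum_le_sum fun l _ => ?_
  simp only [Function.comp_apply, List.length_map]
  have : ∀ l : List ℚ, l.length ≤ (l.map ratLength).sum := by
    intro l
    induction l with
    | nil => simp
    | cons r l ih => simp only [List.length_cons, List.map_cons, List.sum_cons, ratLength]; omega
  exact this l

/-- The real input determines the rational one, so its encoding length can be fixed before `J` is
given. -/
theorem castInput_injective : Function.Injective castInput := by
  rw [funext castInput_eq_map]
  exact List.map_injective_iff.2 (List.map_injective_iff.2 Rat.cast_injective)

end ArithRAM

namespace MusicLab

/-! ### Ranks -/

/-- Lexicographic comparison: `x` descending, then `y` ascending, then the index ascending. -/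
def Precedes (x y : ℕ → ℝ) (l k : ℕ) : Prop :=
  x k < x l ∨ x l = x k ∧ (y l < y k ∨ y l = y k ∧ l < k)

open Classical in
/-- The number of indices below `n` that precede `k`. -/
noncomputable def rankOf (n : ℕ) (x y : ℕ → ℝ) (k : ℕ) : ℕ :=
  ((Finset.range n).filter fun l => Precedes x y l k).card

theorem precedes_irrefl {x y : ℕ → ℝ} (k : ℕ) : ¬ Precedes x y k k := by
  simp [Precedes]

theorem Precedes.trans {x y : ℕ → ℝ} {i j k : ℕ} (h : Precedes x y i j) (h' : Precedes x y j k) :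
    Precedes x y i k := by
  unfold Precedes at *
  grind

/-- The index as last key makes the order total; this is why ranks are distinct and form a
permutation. -/
theorem precedes_trichotomy {x y : ℕ → ℝ} {l k : ℕ} (h : l ≠ k) :
    Precedes x y l k ∨ Precedes x y k l := by
  unfold Precedes
  grind

theorem rankOf_lt_rankOf {n : ℕ} {x y : ℕ → ℝ} {l k : ℕ} (hl : l < n) (h : Precedes x y l k) :
    rankOf n x y l < rankOf n x y k := by
  classical
  refine Finset.card_lt_card ((Finset.ssubset_iff_of_subset fun i hi => ?_).2 ⟨l, ?_, ?_⟩)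
  · simp only [Finset.mem_filter] at hi ⊢
    exact ⟨hi.1, hi.2.trans h⟩
  · simpa [hl] using h
  · simp [precedes_irrefl]

theorem precedes_of_rankOf_lt {n : ℕ} {x y : ℕ → ℝ} {l k : ℕ} (hk : k < n)
    (h : rankOf n x y l < rankOf n x y k) : Precedes x y l k := by
  have hne : l ≠ k := by rintro rfl; exact h.false
  exact (precedes_trichotomy hne).resolve_right fun h' => (rankOf_lt_rankOf hk h').asymm h

theorem rankOf_lt {n : ℕ} {x y : ℕ → ℝ} {k : ℕ} (hk : k < n) : rankOf n x y k < n := by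
  classical
  have : rankOf n x y k < (Finset.range n).card :=
    Finset.card_lt_card ((Finset.ssubset_iff_of_subset (Finset.filter_subset _ _)).2
      ⟨k, by simpa using hk, by simp [precedes_irrefl]⟩)
  simpa using this

theorem rankOf_inj {n : ℕ} {x y : ℕ → ℝ} {l k : ℕ} (hl : l < n) (hk : k < n)
    (h : rankOf n x y l = rankOf n x y k) : l = k := by
  by_contra hne
  rcases precedes_trichotomy (x := x) (y := y) hne with h' | h'
  · exact (rankOf_lt_rankOf hl h').ne h
  · exact (rankOf_lt_rankOf hk h').ne' h

theorem rankOf_congr {n : ℕ} {x y x' y' : ℕ → ℝ} (hx : ∀ i < n, x i = x' i)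
    (hy : ∀ i < n, y i = y' i) {k : ℕ} (hk : k < n) : rankOf n x y k = rankOf n x' y' k := by
  classical
  unfold rankOf
  congr 1
  refine Finset.filter_congr fun l hl => ?_
  have hl := Finset.mem_range.1 hl
  simp [Precedes, hx l hl, hx k hk, hy l hl, hy k hk]

theorem rankOf_le (n : ℕ) (x y : ℕ → ℝ) (k : ℕ) : rankOf n x y k ≤ n := by
  classical
  exact (Finset.card_filter_le _ _).trans (Finset.card_range n).le

theorem rankOf_zero (x y : ℕ → ℝ) (k : ℕ) : rankOf 0 x y k = 0 := by simp [rankOf]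

open Classical in
theorem rankOf_succ (n : ℕ) (x y : ℕ → ℝ) (k : ℕ) :
    rankOf (n + 1) x y k = rankOf n x y k + if Precedes x y n k then 1 else 0 := by
  simp only [rankOf, Finset.range_add_one, Finset.filter_insert]
  split_ifs <;> simp

/-- Ranks as a permutation of the indices. -/
noncomputable def rankPerm (n : ℕ) (x y : ℕ → ℝ) : Equiv.Perm (Fin n) :=
  Equiv.ofBijective (fun k => ⟨rankOf n x y k, rankOf_lt k.2⟩)
    (Finite.injective_iff_bijective.1 fun l k h =>
      Fin.ext (rankOf_inj l.2 k.2 (by simpa using h)))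

@[simp] theorem rankPerm_apply {n : ℕ} (x y : ℕ → ℝ) (k : Fin n) :
    (rankPerm n x y k : ℕ) = rankOf n x y k := rfl

/-! ### Rankings from a multiplier -/

/-- The numerical data of the maximization problem. -/
structure RankingData where
  /-- the number of songs -/
  n : ℕ
  /-- visibilities -/
  v : ℕ → ℝ
  /-- sampling weights -/
  a : ℕ → ℝ
  /-- sampling weights multiplied by qualities -/
  w : ℕ → ℝ

namespace RankingData

variable (P : RankingData)

/-- The songs are matched with the positions in the order of `w i - r * a i`. -/
noncomputable def ranking (r : ℝ) : Equiv.Perm (Fin P.n) :=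
  (rankPerm P.n (fun i => P.w i - r * P.a i) P.a).trans (rankPerm P.n P.v P.v).symm

/-- The position at which the visibility has a given rank. -/
noncomputable def position (m : ℕ) : ℕ :=
  if h : m < P.n then (rankPerm P.n P.v P.v).symm ⟨m, h⟩ else 0

theorem position_rankOf {p : ℕ} (hp : p < P.n) : P.position (rankOf P.n P.v P.v p) = p := by
  rw [position, dif_pos (rankOf_lt hp)]
  have : (⟨rankOf P.n P.v P.v p, rankOf_lt hp⟩ : Fin P.n) = rankPerm P.n P.v P.v ⟨p, hp⟩ :=
    Fin.ext rfl
  rw [this, Equiv.symm_apply_apply]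

theorem exists_rankOf_eq {m : ℕ} (hm : m < P.n) : ∃ p < P.n, rankOf P.n P.v P.v p = m :=
  ⟨(rankPerm P.n P.v P.v).symm ⟨m, hm⟩, Fin.is_lt _, by
    rw [← rankPerm_apply, Equiv.apply_symm_apply]⟩

theorem ranking_apply (r : ℝ) (k : Fin P.n) :
    (P.ranking r k : ℕ) = P.position (rankOf P.n (fun i => P.w i - r * P.a i) P.a k) := by
  rw [position, dif_pos (rankOf_lt k.2)]
  rfl

/-- The numerator of the objective for the ranking with multiplier `r`, first `m` terms. -/
noncomputable def numer (r : ℝ) (m : ℕ) : ℝ :=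
  ∑ k ∈ Finset.range m,
    P.v (P.position (rankOf P.n (fun i => P.w i - r * P.a i) P.a k)) * P.w k

/-- The denominator of the objective for the ranking with multiplier `r`, first `m` terms. -/
noncomputable def denom (r : ℝ) (m : ℕ) : ℝ :=
  ∑ k ∈ Finset.range m,
    P.v (P.position (rankOf P.n (fun i => P.w i - r * P.a i) P.a k)) * P.a k

theorem numer_eq (r : ℝ) : P.numer r P.n = ∑ k : Fin P.n, P.v (P.ranking r k) * P.w k := by
  simp only [numer, ranking_apply]
  rw [Finset.sum_range]

theorem denom_eq (r : ℝ) : P.denom r P.n = ∑ k : Fin P.n, P.v (P.ranking r k) * P.a k := by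
  simp only [denom, ranking_apply]
  rw [Finset.sum_range]

open Classical in
/-- The multiplier at which the songs `i` and `j` change their order. -/
noncomputable def breakpoint (i j : ℕ) : ℝ :=
  if P.a i < P.a j then (P.w i - P.w j) / (P.a i - P.a j) else 0

variable {P}

/-- The order at `μ` remains a valid order up to the next breakpoint. -/
theorem le_of_precedes {μ r : ℝ} (hμ : μ ≤ r)
    (hbr : ∀ i < P.n, ∀ j < P.n, P.breakpoint i j ≤ r → P.breakpoint i j ≤ μ) {l k : ℕ}
    (hl : l < P.n) (hk : k < P.n) (h : Precedes (fun i => P.w i - μ * P.a i) P.a l k) :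
    P.w k - r * P.a k ≤ P.w l - r * P.a l := by
  by_contra! hlt
  have hle : P.w k - μ * P.a k ≤ P.w l - μ * P.a l := by
    rcases h with h | ⟨h, -⟩
    exacts [h.le, h.ge]
  -- The key difference of `l` and `k` is affine in the multiplier with slope `P.a k - P.a l`; it is
  -- nonnegative at `μ` and negative at `r`, so the slope is negative.
  have ha : P.a k < P.a l := by
    by_contra! ha
    nlinarith [mul_nonneg (sub_nonneg.2 hμ) (sub_nonneg.2 ha)]
  -- A tie at `μ` would have been won by `k`, which has the smaller `a`. So the zero of the
  -- difference, a breakpoint, lies strictly above `μ` and at most at `r`, against `hbr`.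
  have hstrict : P.w k - μ * P.a k < P.w l - μ * P.a l := by
    rcases h with h | ⟨-, h | ⟨h, -⟩⟩
    · exact h
    · exact absurd h ha.not_gt
    · exact absurd h ha.ne'
  have hbp : P.breakpoint k l = (P.w l - P.w k) / (P.a l - P.a k) := by
    rw [breakpoint, if_pos ha, ← neg_sub (P.w l), ← neg_sub (P.a l), neg_div_neg_eq]
  have hpos : 0 < P.a l - P.a k := sub_pos.2 ha
  have h1 : P.breakpoint k l ≤ r := by
    rw [hbp, div_le_iff₀ hpos]; nlinarith
  have h2 : μ < P.breakpoint k l := by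
    rw [hbp, lt_div_iff₀ hpos]; nlinarith
  exact (hbr k hk l hl h1).not_gt h2

/-- This is the hypothesis of the rearrangement inequality: the ranking is formed at `μ` but the
keys are taken at `r`, and `le_of_precedes` bridges the gap. -/
theorem ranking_monovary {μ r : ℝ} (hμ : μ ≤ r)
    (hbr : ∀ i < P.n, ∀ j < P.n, P.breakpoint i j ≤ r → P.breakpoint i j ≤ μ) :
    Monovary (fun k : Fin P.n => P.v (P.ranking μ k)) fun k => P.w k - r * P.a k := by
  intro k l hkl
  by_contra! hv
  have hrank : ∀ m : Fin P.n, rankOf P.n P.v P.v (P.ranking μ m) =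
      rankOf P.n (fun i => P.w i - μ * P.a i) P.a m := fun m => by
    rw [← rankPerm_apply, ranking, Equiv.trans_apply, Equiv.apply_symm_apply, rankPerm_apply]
  have h1 : Precedes P.v P.v (P.ranking μ k) (P.ranking μ l) := .inl hv
  have h2 := rankOf_lt_rankOf (Fin.is_lt _) h1
  rw [hrank, hrank] at h2
  exact (le_of_precedes hμ hbr k.2 l.2 (precedes_of_rankOf_lt l.2 h2)).not_gt hkl

/-- Every objective value is reached or exceeded by the ranking of some breakpoint. -/
theorem exists_breakpoint_le (hn : 0 < P.n)
    (hpos : ∀ σ : Equiv.Perm (Fin P.n), 0 < ∑ k, P.v (σ k) * P.a k)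
    (hnum : ∀ σ : Equiv.Perm (Fin P.n), 0 ≤ ∑ k, P.v (σ k) * P.w k) (τ : Equiv.Perm (Fin P.n)) :
    ∃ i < P.n, ∃ j < P.n, (∑ k, P.v (τ k) * P.w k) / (∑ k, P.v (τ k) * P.a k) ≤
      P.numer (P.breakpoint i j) P.n / P.denom (P.breakpoint i j) P.n := by
  classical
  set r := (∑ k, P.v (τ k) * P.w k) / (∑ k, P.v (τ k) * P.a k) with hr
  have hr0 : 0 ≤ r := div_nonneg (hnum τ) (hpos τ).le
  let C := ((Finset.range P.n ×ˢ Finset.range P.n).filter fun ij => P.breakpoint ij.1 ij.2 ≤ r)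
  -- The pair (0, 0) has breakpoint 0 by the default value, and 0 ≤ r.
  have hC : C.Nonempty := ⟨(0, 0), by
    have h0 : P.breakpoint 0 0 = 0 := by simp [breakpoint]
    simp [C, hn, h0, hr0]⟩
  obtain ⟨⟨i, j⟩, hij, hmax⟩ := C.exists_max_image (fun ij => P.breakpoint ij.1 ij.2) hC
  simp only [C, Finset.mem_filter, Finset.mem_product, Finset.mem_range, Prod.forall,
    and_imp] at hij hmax
  refine ⟨i, hij.1.1, j, hij.1.2, ?_⟩
  set μ := P.breakpoint i j
  have hmono := ranking_monovary hij.2 fun i' hi' j' hj' h => hmax i' j' hi' hj' h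
  -- The permutation is chosen so that following it by the ranking at `μ` gives `τ`.
  have hrear := hmono.sum_comp_perm_mul_le_sum_mul (σ := τ.trans (P.ranking μ).symm)
  simp only [Equiv.trans_apply, Equiv.apply_symm_apply] at hrear
  have hexp : ∀ σ : Equiv.Perm (Fin P.n), ∑ k, P.v (σ k) * (P.w k - r * P.a k) =
      ∑ k, P.v (σ k) * P.w k - r * ∑ k, P.v (σ k) * P.a k := fun σ => by
    rw [Finset.mul_sum, ← Finset.sum_sub_distrib]
    exact Finset.sum_congr rfl fun k _ => by ring
  rw [hexp, hexp] at hrear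
  -- The linear objective vanishes at `τ`, so it is nonnegative at the ranking of `μ`, whose
  -- quotient is therefore at least `r`.
  have hτ : r * ∑ k, P.v (τ k) * P.a k = ∑ k, P.v (τ k) * P.w k := div_mul_cancel₀ _ (hpos τ).ne'
  rw [numer_eq, denom_eq, le_div_iff₀ (hpos _)]
  linarith

end RankingData

end MusicLab

namespace MusicLab

open ArithRAM

/-! ### The program

Integer variables: `0` holds the number of songs and `4` holds `1`; `5`, `6`, `7`, `8` are loop
counters, `9` holds a rank and `10` a position.  Integer array `0` holds the ranking, and integer
array `1` holds the positions in the order of their visibilities.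

Number arrays: `0` to `4` are the input, `5` and `6` hold sampling weights without and with the
quality as a factor, `7` the multiplier, `11` the keys by which the songs are ordered, `13` and `15`
numerator and denominator of the objective value `16`, `17` and `18` the best value found so far and
its multiplier; the other ones hold intermediate results. -/

/-- The cell at address `0` of a number array. -/
def scalar (a : ℕ) : Cell := ⟨a, .lit 0⟩

/-- The cell of a number array at the address in an integer variable. -/
def entry (a x : ℕ) : Cell := ⟨a, .var x⟩

/-- Count in integer variable `9` how many indices precede the one in `k`. -/
def countPreceding (x y k : ℕ) : Cmd :=
  .seq (.intConst 9 0) <| .forLoop 4 0 8 <|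
    .ite (.numLt (entry x k) (entry x 8)) (.intAdd 9 9 4) <|
    .ite (.numLt (entry x 8) (entry x k)) .skip <|
    .ite (.numLt (entry y 8) (entry y k)) (.intAdd 9 9 4) <|
    .ite (.numLt (entry y k) (entry y 8)) .skip <|
    .ite (.intLt 8 k) (.intAdd 9 9 4) .skip

/-- Compute the sampling weights. -/
def computeWeights : Cmd :=
  .forLoop 4 0 5 <|
    .seq (.numOp .mul (scalar 19) (scalar 4) (entry 0 5)) <|
    .seq (.numOp .add (entry 5 5) (scalar 19) (entry 1 5)) <|
    .numOp .mul (entry 6 5) (entry 5 5) (entry 2 5)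

/-- Sort the positions by visibility. -/
def sortPositions : Cmd :=
  .forLoop 4 0 5 <| .seq (countPreceding 3 3 5) (.intStore 1 (.var 9) 5)

/-- Compute the keys for the multiplier in array `7`. -/
def computeKeys : Cmd :=
  .forLoop 4 0 7 <|
    .seq (.numOp .mul (scalar 10) (scalar 7) (entry 5 7)) <|
    .numOp .sub (entry 11 7) (entry 6 7) (scalar 10)

/-- Compute the ranking given by the keys, and the two sums in its objective value. -/
def computeSums : Cmd :=
  .forLoop 4 0 7 <|
    .seq (countPreceding 11 5 7) <|
    .seq (.intLoad 10 1 (.var 9)) <|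
    .seq (.intStore 0 (.var 7) 10) <|
    .seq (.numOp .mul (scalar 12) (entry 3 10) (entry 6 7)) <|
    .seq (.numOp .add (scalar 13) (scalar 13) (scalar 12)) <|
    .seq (.numOp .mul (scalar 14) (entry 3 10) (entry 5 7)) <|
    .numOp .add (scalar 15) (scalar 15) (scalar 14)

/-- Compute the ranking for the multiplier in array `7` and its objective value. -/
def computeRanking : Cmd :=
  .seq computeKeys <|
  .seq (.numConst (scalar 13) 0) <|
  .seq (.numConst (scalar 15) 0) <|
  .seq computeSums <|
  .numOp .div (scalar 16) (scalar 13) (scalar 15)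

/-- Compute the breakpoint of a pair of songs. -/
def computeBreakpoint : Cmd :=
  .ite (.numLt (entry 5 5) (entry 5 6))
    (.seq (.numOp .sub (scalar 8) (entry 6 5) (entry 6 6)) <|
      .seq (.numOp .sub (scalar 9) (entry 5 5) (entry 5 6)) <|
      .numOp .div (scalar 7) (scalar 8) (scalar 9))
    (.numConst (scalar 7) 0)

/-- Replace the best multiplier found so far if the current one is better. -/
def updateBest : Cmd :=
  .ite (.numLt (scalar 17) (scalar 16))
    (.seq (.numCopy (scalar 17) (scalar 16)) (.numCopy (scalar 18) (scalar 7))) .skip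

/-- Find the best multiplier among the breakpoints. -/
def searchBreakpoints : Cmd :=
  .forLoop 4 0 5 <| .forLoop 4 0 6 <|
    .seq computeBreakpoint <| .seq computeRanking updateBest

/-- The program that computes a performance ranking. -/
def performanceRanking : Cmd :=
  .seq computeWeights <|
  .seq sortPositions <|
  .seq searchBreakpoints <|
  .seq (.numCopy (scalar 7) (scalar 18)) computeRanking

/-! ### Correctness of the program -/

/-- The encoding lengths of the numbers in the arrays of the program. -/
def arrayBits (L n a : ℕ) : ℕ :=
  -- Products and quotients add lengths; sums and differences cost one more bit. Thus αA + D has 2L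
  -- + L + 1 bits, a breakpoint (8L + 3) + (6L + 3), a key (4L + 1) + (17L + 7) + 1. A sum of n
  -- terms of 5L + 1 bits gets n(5L + 2), and the objective value adds the lengths of the two sums.
  [L, L, L, L, L, 3 * L + 1, 4 * L + 1, 14 * L + 6, 8 * L + 3, 6 * L + 3, 17 * L + 7, 21 * L + 9,
    5 * L + 1, n * (5 * L + 2), 4 * L + 1, n * (4 * L + 2), n * (9 * L + 4), n * (9 * L + 4),
    14 * L + 6, 2 * L].getD a 0

/-- The bound on the numbers in array `a`; it is claimed under the condition `R`. -/
def SizeBound (R : Prop) (L n a : ℕ) (x : ℝ) : Prop := R → HasBits (arrayBits L n a) x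

variable {R : Prop} {L N : ℕ}

/-- After `i` rounds the variable holds the rank among the first `i` indices, by the recursion
`rankOf_succ`. The body costs 6: at most five nested tests and one leaf. -/
theorem countPreceding_runs {G : ℕ → ℝ → Prop} {n : ℕ} {s : State} (x y k : ℕ)
    (hn : s.ivar 0 = n) (h1 : s.ivar 4 = 1) (h8 : k ≠ 8) (h9 : k ≠ 9) :
    Runs G N (countPreceding x y k) s (n * 9 + 5)
      fun s' => s'.ivar 9 = rankOf n (s.num x) (s.num y) (s.ivar k) := by
  refine .of_bounded fun hs => ?_
  have hnN : n ≤ N := hn ▸ hs.ivar 0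
  refine .mono (.seq (.intConst (Nat.zero_le N) (.forLoop (n := n) (T := 6)
    (fun i s' => s'.ivar 9 = rankOf i (s.num x) (s.num y) (s.ivar k))
    (by simpa using hn) (by simpa using h1) (by decide) (by decide) ?_ ?_ ?_ ?_ ?_ ?_)))
    (by omega) fun _ h => h
  · simp [Cmd.varsWritten]
  · simp [Cmd.varsWritten]
  · simp [Cmd.varsWritten]
  · intro i s' k' h; simpa using h
  · simp [rankOf_zero]
  · intro i hi s' hag h8' hI
    have hnum : s'.num = s.num := by
      funext a
      rw [hag.num a (by simp [Cmd.numsWritten_forLoop, Cmd.numsWritten])]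
      rfl
    have h4 : s'.ivar 4 = 1 := by
      rw [hag.ivar 4 (by simp [Cmd.varsWritten_forLoop, Cmd.varsWritten])]
      simpa using h1
    have hk : s'.ivar k = s.ivar k := by
      rw [hag.ivar k (by simp [Cmd.varsWritten_forLoop, Cmd.varsWritten, h8, h9])]
      simp [h9]
    have hle : s'.ivar 9 + s'.ivar 4 ≤ N := by
      have := rankOf_le i (s.num x) (s.num y) (s.ivar k)
      omega
    have hinc : Precedes (s.num x) (s.num y) i (s.ivar k) → Runs G N (.intAdd 9 9 4) s' 1
        fun s' => s'.ivar 9 = rankOf (i + 1) (s.num x) (s.num y) (s.ivar k) := fun h =>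
      .intAdd hle (by simp [rankOf_succ, h, hI, h4])
    have hskip : ¬ Precedes (s.num x) (s.num y) i (s.ivar k) → Runs G N .skip s' 1
        fun s' => s'.ivar 9 = rankOf (i + 1) (s.num x) (s.num y) (s.ivar k) := fun h =>
      .skip (by simp [rankOf_succ, h, hI])
    simp only [Precedes] at hinc hskip
    refine .mono (.ite (fun h => hinc ?_) fun h₁ => .ite (fun h => hskip ?_) fun h₂ =>
      .ite (fun h => hinc ?_) fun h₃ => .ite (fun h => hskip ?_) fun h₄ =>
      .ite (fun h => hinc ?_) fun h => hskip ?_) (by norm_num) fun _ h => h <;>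
    simp only [Test.Holds, State.getNum, entry, Addr.eval, hnum, hk, h8'] at * <;> grind

/-- The memory holds the data `P` and the positions sorted by visibility. -/
structure Loaded (P : RankingData) (s : State) : Prop where
  n : s.ivar 0 = P.n
  one : s.ivar 4 = 1
  v : ∀ i, s.num 3 i = P.v i
  a : ∀ i < P.n, s.num 5 i = P.a i
  w : ∀ i < P.n, s.num 6 i = P.w i
  position : ∀ m < P.n, s.idx 1 m = P.position m

/-- The side conditions concern only the program text, so preservation of the data is checked by
`decide`. -/
theorem Loaded.of_agreeOff {P : RankingData} {c : Cmd} {s s' : State} (h : Loaded P s)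
    (hag : AgreeOff c s s') (hv : ∀ x ∈ [0, 4], x ∉ c.varsWritten) (hi : 1 ∉ c.idxsWritten)
    (hn : ∀ x ∈ [3, 5, 6], x ∉ c.numsWritten) : Loaded P s' where
  n := by rw [hag.ivar 0 (hv _ (by simp)), h.n]
  one := by rw [hag.ivar 4 (hv _ (by simp)), h.one]
  v := by rw [hag.num 3 (hn _ (by simp))]; exact h.v
  a := by rw [hag.num 5 (hn _ (by simp))]; exact h.a
  w := by rw [hag.num 6 (hn _ (by simp))]; exact h.w
  position := by rw [hag.idx 1 hi]; exact h.position

theorem computeKeys_runs {P : RankingData} {s : State} (h : Loaded P s) :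
    Runs (SizeBound R L P.n) N computeKeys s (P.n * 6 + 3)
      fun s' => ∀ k < P.n, s'.num 11 k = P.w k - s.num 7 0 * P.a k := by
  refine .mono (.forLoop (n := P.n) (T := 3)
    (fun i s' => ∀ k < i, s'.num 11 k = P.w k - s.num 7 0 * P.a k) h.n h.one (by decide)
    (by decide) (by decide) (by decide) (by decide) (fun _ _ _ h => h) (by simp) ?_)
    (by omega) fun _ h => h
  intro i hi s' hag h7 hI
  have ha : s'.num 5 i = P.a i := by rw [hag.num 5 (by decide), h.a i hi]
  have hw : s'.num 6 i = P.w i := by rw [hag.num 6 (by decide), h.w i hi]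
  have hr : s'.num 7 0 = s.num 7 0 := by rw [hag.num 7 (by decide)]
  refine .mono (.seq (.numOp rfl (fun h h' hR => ?_) (.numOp rfl (fun h h' hR => ?_) ?_)))
    (by norm_num) fun _ h => h
  · exact (h hR).mul (h' hR) (by simp [arrayBits, scalar, entry]; omega)
  · exact (h hR).sub (h' hR) (by simp [arrayBits, scalar, entry]; omega)
  · intro k hk
    by_cases hki : k = i
    · subst hki; simp [scalar, entry, State.getNum, Addr.eval, h7, ha, hw, hr]
    · have := hI k (by omega)
      simp [scalar, entry, State.getNum, Addr.eval, h7, hki, this]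

theorem computeSums_runs {P : RankingData} {r : ℝ} {s : State} (h : Loaded P s)
    (hkey : ∀ k < P.n, s.num 11 k = P.w k - r * P.a k) (h13 : s.num 13 0 = 0)
    (h15 : s.num 15 0 = 0) :
    Runs (SizeBound R L P.n) N computeSums s (P.n * (P.n * 9 + 20) + 3)
      fun s' => s'.num 13 0 = P.numer r P.n ∧ s'.num 15 0 = P.denom r P.n ∧
        ∀ k < P.n, s'.idx 0 k = P.position (rankOf P.n (fun i => P.w i - r * P.a i) P.a k) := by
  refine .mono (.forLoop (n := P.n) (T := P.n * 9 + 17)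
    (fun i s' => s'.num 13 0 = P.numer r i ∧ s'.num 15 0 = P.denom r i ∧
      -- The bound for array 13 alone is not inductive, since each addition lengthens the sum; the
      -- invariant needs a bound growing with `i`. The same holds for array 15.
      (R → HasBits (i * (5 * L + 2)) (s'.num 13 0)) ∧
      (R → HasBits (i * (4 * L + 2)) (s'.num 15 0)) ∧
      ∀ k < i, s'.idx 0 k = P.position (rankOf P.n (fun i => P.w i - r * P.a i) P.a k))
    h.n h.one (by decide)
    (by decide) (by decide) (by decide) (by decide) (fun _ _ _ h => h) ?_ ?_)
    le_rfl fun _ h => ⟨h.1, h.2.1, h.2.2.2.2⟩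
  · simp [h13, h15, RankingData.numer, RankingData.denom, HasBits.zero]
  intro i hi s' hag h7 ⟨hI13, hI15, hB13, hB15, hI0⟩
  have hL := h.of_agreeOff hag (by decide) (by decide) (by decide)
  have hrank : rankOf P.n (s'.num 11) (s'.num 5) (s'.ivar 7) =
      rankOf P.n (fun i => P.w i - r * P.a i) P.a i := by
    rw [h7]
    exact rankOf_congr (fun k hk => by rw [hag.num 11 (by decide), hkey k hk]) hL.a hi
  set m := rankOf P.n (fun i => P.w i - r * P.a i) P.a i with hm
  have hmn : m < P.n := rankOf_lt hi
  refine .mono (.seq (.consequence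
    (countPreceding_runs 11 5 7 hL.n hL.one (by decide) (by decide)) le_rfl
    fun s₁ hag₁ hs₁ h9 => ?_)) (T := 11 + (P.n * 9 + 5) + 1) (by omega) fun _ h => h
  rw [hrank] at h9
  have hL₁ := hL.of_agreeOff hag₁ (by decide) (by decide) (by decide)
  have h7₁ : s₁.ivar 7 = i := by rw [hag₁.ivar 7 (by decide), h7]
  rw [← hag₁.num 13 (by decide)] at hI13 hB13
  rw [← hag₁.num 15 (by decide)] at hI15 hB15
  rw [← hag₁.idx 0 (by decide)] at hI0
  have hpos := hL₁.position m hmn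
  have hle' : ∀ b, (i + 1) * b ≤ P.n * b := fun b => Nat.mul_le_mul_right b hi
  have hv := hs₁.num 3 (P.position m)
  have ha := hs₁.num 5 i
  have hw := hs₁.num 6 i
  simp only [SizeBound, arrayBits, List.getD_cons_succ, List.getD_cons_zero] at hv ha hw
  have hB13' : R → HasBits ((i + 1) * (5 * L + 2))
      (s₁.num 13 0 + s₁.num 3 (P.position m) * s₁.num 6 i) := fun hR =>
    (hB13 hR).add ((hv hR).mul (hw hR) le_rfl) (by rw [Nat.succ_mul i]; omega)
  have hB15' : R → HasBits ((i + 1) * (4 * L + 2))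
      (s₁.num 15 0 + s₁.num 3 (P.position m) * s₁.num 5 i) := fun hR =>
    (hB15 hR).add ((hv hR).mul (ha hR) le_rfl) (by rw [Nat.succ_mul i]; omega)
  refine .mono (.seq (.intLoad (.seq (.intStore (.seq (.numOp rfl (fun h h' hR => ?_)
    (.seq (.numOp rfl (fun h h' hR => ?_) (.seq (.numOp rfl (fun h h' hR => ?_)
    (.numOp rfl (fun h h' hR => ?_) ?_))))))))))) (by norm_num) fun _ h => h
  · exact (h hR).mul (h' hR) (by simp [arrayBits, scalar, entry]; omega)
  · have := (hB13' hR).mono (hle' (5 * L + 2))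
    simpa [arrayBits, scalar, entry, State.getNum, Addr.eval, h7₁, h9, hpos] using this
  · exact (h hR).mul (h' hR) (by simp [arrayBits, scalar, entry]; omega)
  · have := (hB15' hR).mono (hle' (4 * L + 2))
    simpa [arrayBits, scalar, entry, State.getNum, Addr.eval, h7₁, h9, hpos] using this
  · simp only [scalar, entry, State.getNum, Addr.eval, State.setNum_num, State.setVar_num,
      State.setIdx_num, State.setNum_ivar, State.setVar_ivar, State.setIdx_ivar, State.setNum_idx,
      State.setIdx_idx, State.setVar_idx]
    norm_num [h7₁, h9, hpos]
    refine ⟨?_, ?_, hB13', hB15', fun k hk => ?_⟩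
    · rw [RankingData.numer, Finset.sum_range_succ, ← RankingData.numer, hI13, hL₁.v,
        hL₁.w i hi]
    · rw [RankingData.denom, Finset.sum_range_succ, ← RankingData.denom, hI15, hL₁.v,
        hL₁.a i hi]
    · split_ifs with hki
      · rw [hki]
      · exact hI0 k (by omega)

end MusicLab

/-! ### Evaluating a multiplier and searching the breakpoints -/

namespace MusicLab

open ArithRAM

variable {R : Prop} {L N : ℕ}

theorem computeRanking_runs {P : RankingData} {s : State} (h : Loaded P s)
    (hden : P.denom (s.num 7 0) P.n ≠ 0) :
    Runs (SizeBound R L P.n) N computeRanking s (P.n * (P.n * 9 + 26) + 13)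
      fun s' => s'.num 16 0 = P.numer (s.num 7 0) P.n / P.denom (s.num 7 0) P.n ∧
        ∀ k < P.n, s'.idx 0 k =
          P.position (rankOf P.n (fun i => P.w i - s.num 7 0 * P.a i) P.a k) := by
  refine .mono (.seq (.consequence (computeKeys_runs h) le_rfl fun s₁ hag₁ hs₁ hkey =>
    .seq (.numConst (fun _ => by simpa using HasBits.zero) (.seq (.numConst
      (fun _ => by simpa using HasBits.zero) (.seq (.consequence
      (computeSums_runs (P := P) (r := s.num 7 0) ?_ ?_ ?_ ?_) le_rfl
      fun s₂ hag₂ hs₂ ⟨h13, h15, h0⟩ => .numOp (r := s₂.num 13 0 / s₂.num 15 0) ?_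
        (fun h h' hR => (h hR).div (h' hR) ?_) ?_)))))))
    (T := (1 + (P.n * (P.n * 9 + 20) + 3) + 1) + 1 + 1 + 1 + 1 + (P.n * 6 + 3) + 1)
    (by rw [Nat.mul_add P.n _ 26, Nat.mul_add P.n _ 20]; omega) fun _ h => h
  · exact (h.of_agreeOff (c := computeRanking) (hag₁.mono (by decide) (by decide) (by decide))
      (by decide) (by decide) (by decide)).of_agreeOff (c := computeRanking)
      (((AgreeOff.of_step (c := .numConst (scalar 13) 0) fun _ => rfl).mono
        (by decide) (by decide) (by decide)).trans
      ((AgreeOff.of_step (c := .numConst (scalar 15) 0) fun _ => rfl).mono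
        (by decide) (by decide) (by decide))) (by decide) (by decide) (by decide)
  · simpa [scalar] using hkey
  · simp [scalar, Addr.eval]
  · simp [scalar, Addr.eval]
  · simp [ArithOp.eval?, scalar, State.getNum, Addr.eval, h15, hden]
  · simp only [scalar, arrayBits, List.getD_cons_succ, List.getD_cons_zero, ← Nat.mul_add]
    exact Nat.mul_le_mul_left _ (by omega)
  · refine ⟨by simp [scalar, Addr.eval, h13, h15], h0⟩

theorem computeBreakpoint_runs {P : RankingData} {s : State} (h : Loaded P s) {i j : ℕ}
    (hi : i < P.n) (hj : j < P.n) (h5 : s.ivar 5 = i) (h6 : s.ivar 6 = j) :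
    Runs (SizeBound R L P.n) N computeBreakpoint s 6
      fun s' => s'.num 7 0 = P.breakpoint i j := by
  have hai : s.num 5 (s.ivar 5) = P.a i := by rw [h5, h.a i hi]
  have haj : s.num 5 (s.ivar 6) = P.a j := by rw [h6, h.a j hj]
  have hwi : s.num 6 (s.ivar 5) = P.w i := by rw [h5, h.w i hi]
  have hwj : s.num 6 (s.ivar 6) = P.w j := by rw [h6, h.w j hj]
  have htest : (Test.numLt (entry 5 5) (entry 5 6)).Holds s ↔ P.a i < P.a j := by
    simp [Test.Holds, State.getNum, entry, Addr.eval, hai, haj]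
  refine .mono (.ite (fun hlt => .seq (.numOp rfl (fun g g' hR => ?_)
    (.seq (.numOp rfl (fun g g' hR => ?_) (.numOp (r := (P.w i - P.w j) / (P.a i - P.a j)) ?_
      (fun g g' hR => ?_) ?_)))))
    (fun hle => .numConst (fun _ => by simpa using HasBits.zero) ?_)) (by norm_num) fun _ h => h
  · exact (g hR).sub (g' hR) (by simp [arrayBits, entry, scalar]; omega)
  · exact (g hR).sub (g' hR) (by simp [arrayBits, entry, scalar]; omega)
  · have hne : P.a i - P.a j ≠ 0 := (sub_neg.2 (htest.1 hlt)).ne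
    simp [ArithOp.eval?, State.getNum, entry, scalar, Addr.eval, hai, haj, hwi, hwj, hne]
  · have hw := g hR
    have ha := g' hR
    simp only [State.getNum, entry, scalar, Addr.eval, State.setNum_num, State.setNum_ivar, hai,
      haj, hwi, hwj] at hw ha
    norm_num at hw ha
    exact hw.div ha (by simp [arrayBits, scalar]; omega)
  · simp [scalar, Addr.eval, RankingData.breakpoint, htest.1 hlt]
  · simp [scalar, Addr.eval, RankingData.breakpoint, htest.not.1 hle]

/-- The best value so far is at most the value of the best multiplier so far. -/
def BestAttained (P : RankingData) (s : State) : Prop :=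
  s.num 17 0 ≤ P.numer (s.num 18 0) P.n / P.denom (s.num 18 0) P.n

theorem updateBest_runs {P : RankingData} {s : State} (hb : BestAttained P s)
    (hval : s.num 16 0 = P.numer (s.num 7 0) P.n / P.denom (s.num 7 0) P.n) :
    Runs (SizeBound R L P.n) N updateBest s 4
      fun s' => BestAttained P s' ∧ s.num 17 0 ≤ s'.num 17 0 ∧ s.num 16 0 ≤ s'.num 17 0 := by
  refine .mono (.ite (fun hlt => .seq (.numCopy (fun h hR => ?_) (.numCopy (fun h hR => ?_) ?_)))
    (fun hle => .skip ?_)) (by norm_num) fun _ h => h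
  · simpa [arrayBits, scalar] using h hR
  · simpa [arrayBits, scalar] using h hR
  · have hlt' : s.num 17 0 < s.num 16 0 := hlt
    simpa [BestAttained, scalar, State.getNum, Addr.eval, hval] using hval ▸ hlt'.le
  · exact ⟨hb, le_rfl, not_lt.1 hle⟩

/-- The best value never decreases, so a pair once evaluated stays dominated. `hden` is required for
all multipliers because each evaluation divides by such a denominator. -/
theorem searchBreakpoints_runs {P : RankingData} {s : State} (h : Loaded P s)
    (hden : ∀ r, P.denom r P.n ≠ 0) (hb : BestAttained P s) :
    Runs (SizeBound R L P.n) N searchBreakpoints s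
      (P.n * (P.n * (P.n * (P.n * 9 + 26) + 28) + 6) + 3)
      fun s' => BestAttained P s' ∧ ∀ i < P.n, ∀ j < P.n,
        P.numer (P.breakpoint i j) P.n / P.denom (P.breakpoint i j) P.n ≤ s'.num 17 0 := by
  let Ev (i j : ℕ) (s : State) : Prop :=
    P.numer (P.breakpoint i j) P.n / P.denom (P.breakpoint i j) P.n ≤ s.num 17 0
  refine .mono (.forLoop (n := P.n) (T := P.n * (P.n * (P.n * 9 + 26) + 28) + 3)
    (fun i s' => BestAttained P s' ∧ ∀ i' < i, ∀ j < P.n, Ev i' j s')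
    h.n h.one (by decide) (by decide) (by decide) (by decide) (by decide) (fun _ _ _ h => h)
    ⟨hb, by simp⟩ fun i hi s₁ hag₁ h5 ⟨hb₁, hI⟩ => ?_) le_rfl fun _ h => h
  have hL₁ := h.of_agreeOff hag₁ (by decide) (by decide) (by decide)
  refine .mono (.forLoop (n := P.n) (T := P.n * (P.n * 9 + 26) + 25)
    (fun j s' => BestAttained P s' ∧ (∀ i' < i, ∀ j < P.n, Ev i' j s') ∧ ∀ j' < j, Ev i j' s')
    hL₁.n hL₁.one (by decide) (by decide) (by decide) (by decide) (by decide) (fun _ _ _ h => h)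
    ⟨hb₁, hI, by simp⟩ fun j hj s₂ hag₂ h6 ⟨hb₂, hI₂, hJ₂⟩ => ?_) le_rfl
    fun s' ⟨hb', hI', hJ'⟩ => ⟨hb', fun i' hi' j hj => ?_⟩
  swap
  · rcases Nat.lt_succ_iff_lt_or_eq.1 hi' with hlt | rfl
    exacts [hI' i' hlt j hj, hJ' j hj]
  have hL₂ := hL₁.of_agreeOff hag₂ (by decide) (by decide) (by decide)
  have h5₂ : s₂.ivar 5 = i := by rw [hag₂.ivar 5 (by decide), h5]
  refine .mono (.seq (.consequence (computeBreakpoint_runs hL₂ hi hj h5₂ h6) le_rfl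
    fun s₃ hag₃ _ h7 => .seq (.consequence (computeRanking_runs (hL₂.of_agreeOff hag₃ (by decide)
      (by decide) (by decide)) (hden _)) le_rfl fun s₄ hag₄ _ hval =>
      .consequence (updateBest_runs ?_ ?_) le_rfl fun s₅ _ _ ⟨hb₅, hle, hge⟩ =>
        ⟨hb₅, fun i' hi' j hj => ?_, fun j' hj' => ?_⟩)))
    (T := 4 + (P.n * (P.n * 9 + 26) + 13) + 1 + 6 + 1) (by omega) fun _ h => h
  · rw [BestAttained, hag₄.num 17 (by decide), hag₄.num 18 (by decide), hag₃.num 17 (by decide),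
      hag₃.num 18 (by decide)]
    exact hb₂
  · rw [hval.1, hag₄.num 7 (by decide)]
  · rw [hag₄.num 17 (by decide), hag₃.num 17 (by decide)] at hle
    exact (hI₂ i' hi' j hj).trans hle
  · rw [hag₄.num 17 (by decide), hag₃.num 17 (by decide)] at hle
    rcases Nat.lt_succ_iff_lt_or_eq.1 hj' with hlt | rfl
    · exact (hJ₂ j' hlt).trans hle
    · rw [hval.1, h7] at hge
      exact hge

end MusicLab

/-! ### Preprocessing: sampling weights and sorted positions -/

namespace MusicLab

open ArithRAM

variable {R : Prop} {L N : ℕ}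

theorem computeWeights_runs {n : ℕ} {s : State} (hn : s.ivar 0 = n) (h1 : s.ivar 4 = 1) :
    Runs (SizeBound R L n) N computeWeights s (n * 8 + 3)
      fun s' => ∀ i < n, s'.num 5 i = s.num 4 0 * s.num 0 i + s.num 1 i ∧
        s'.num 6 i = (s.num 4 0 * s.num 0 i + s.num 1 i) * s.num 2 i := by
  refine .mono (.forLoop (n := n) (T := 5)
    (fun i s' => ∀ k < i, s'.num 5 k = s.num 4 0 * s.num 0 k + s.num 1 k ∧
        s'.num 6 k = (s.num 4 0 * s.num 0 k + s.num 1 k) * s.num 2 k) hn h1 (by decide)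
    (by decide) (by decide) (by decide) (by decide) (fun _ _ _ h => h) (by simp) ?_)
    (by omega) fun _ h => h
  intro i hi s' hag h5 hI
  rw [← hag.num 0 (by decide), ← hag.num 1 (by decide), ← hag.num 2 (by decide),
    ← hag.num 4 (by decide)] at hI ⊢
  refine .mono (.seq (.numOp rfl (fun h h' hR => ?_) (.seq (.numOp rfl (fun h h' hR => ?_)
    (.numOp rfl (fun h h' hR => ?_) ?_))))) (by norm_num) fun _ h => h
  · exact (h hR).mul (h' hR) (by simp [arrayBits, scalar, entry]; omega)
  · exact (h hR).add (h' hR) (by simp [arrayBits, scalar, entry]; omega)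
  · exact (h hR).mul (h' hR) (by simp [arrayBits, entry]; omega)
  · intro k hk
    by_cases hki : k = i
    · subst hki; simp [scalar, entry, State.getNum, Addr.eval, h5]
    · have := hI k (by omega)
      simp [scalar, entry, State.getNum, Addr.eval, h5, hki, this]

/-- Each position is stored at its rank. Ranks are injective, so no entry is overwritten, and
surjective, so every address below `P.n` is filled. -/
theorem sortPositions_runs {G : ℕ → ℝ → Prop} {P : RankingData} {s : State} (hn : s.ivar 0 = P.n)
    (h1 : s.ivar 4 = 1) (hv : s.num 3 = P.v) :
    Runs G N sortPositions s (P.n * (P.n * 9 + 10) + 3)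
      fun s' => ∀ m < P.n, s'.idx 1 m = P.position m := by
  refine .mono (.forLoop (n := P.n) (T := P.n * 9 + 7)
    (fun i s' => ∀ p < i, s'.idx 1 (rankOf P.n P.v P.v p) = p) hn h1 (by decide)
    (by decide) (by decide) (by decide) (by decide) (fun _ _ _ h => h) (by simp) ?_)
    le_rfl fun s' h m hm => ?_
  · intro i hi s' hag h5 hI
    have hv' : s'.num 3 = P.v := by rw [hag.num 3 (by decide), hv]
    refine .mono (.seq (.consequence (countPreceding_runs 3 3 5
      (n := P.n) (by rw [hag.ivar 0 (by decide), hn]) (by rw [hag.ivar 4 (by decide), h1])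
      (by decide) (by decide)) le_rfl fun s₁ hag₁ _ h9 => .intStore fun p hp => ?_))
      (T := 1 + (P.n * 9 + 5) + 1) (by omega) fun _ h => h
    rw [h5, hv'] at h9
    have h5₁ : s₁.ivar 5 = i := by rw [hag₁.ivar 5 (by decide), h5]
    simp only [State.setIdx_idx, Addr.eval, h9, h5₁, true_and]
    split_ifs with h
    · exact (rankOf_inj (by omega) hi h).symm
    · rw [hag₁.idx 1 (by decide)]
      refine hI p (Nat.lt_of_le_of_ne (by omega) ?_)
      rintro rfl
      exact h rfl
  · obtain ⟨p, hp, rfl⟩ := P.exists_rankOf_eq hm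
    rw [h p hp, P.position_rankOf hp]

/-! ### Optimality for a market and the run of the whole program -/

namespace Market

variable {n : ℕ} (M : Market n)

/-- The numerical data of a market, extended by zeros. -/
noncomputable def rankingData : RankingData where
  n := n
  -- The data are read off the initial memory, which makes the two agree by `rfl`.
  v i := (State.ofInput M.input).num 3 i
  a i := (State.ofInput M.input).num 4 0 * (State.ofInput M.input).num 0 i +
    (State.ofInput M.input).num 1 i
  w i := ((State.ofInput M.input).num 4 0 * (State.ofInput M.input).num 0 i +
    (State.ofInput M.input).num 1 i) * (State.ofInput M.input).num 2 i

theorem rankingData_v (p : Fin n) : M.rankingData.v p = M.v p := by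
  simp [rankingData, State.ofInput, input]

theorem rankingData_a (i : Fin n) : M.rankingData.a i = M.α * M.A i + M.D i := by
  simp [rankingData, State.ofInput, input]

theorem rankingData_w (i : Fin n) : M.rankingData.w i = (M.α * M.A i + M.D i) * M.q i := by
  simp [rankingData, State.ofInput, input]

theorem weight_nonneg (i : Fin n) : 0 ≤ M.α * M.A i + M.D i :=
  add_nonneg (mul_nonneg M.α_pos.le (M.A_nonneg i)) (Nat.cast_nonneg _)

theorem expectedDownloads_eq (σ : Equiv.Perm (Fin n)) :
    M.expectedDownloads σ = (∑ k : Fin n, M.rankingData.v (σ k) * M.rankingData.w k) /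
      ∑ k : Fin n, M.rankingData.v (σ k) * M.rankingData.a k := by
  simp only [rankingData_v, rankingData_a, rankingData_w, expectedDownloads, samplingProb]
  rw [Finset.sum_div]
  exact Finset.sum_congr rfl fun i _ => by ring

theorem denominator_pos (σ : Equiv.Perm (Fin n)) :
    0 < ∑ k : Fin n, M.rankingData.v (σ k) * M.rankingData.a k := by
  simp only [rankingData_v, rankingData_a]
  exact lt_of_le_of_ne (Finset.sum_nonneg fun i _ => mul_nonneg (M.v_nonneg _) (M.weight_nonneg i))
    (M.total_ne_zero σ).symm

theorem numerator_nonneg (σ : Equiv.Perm (Fin n)) :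
    0 ≤ ∑ k : Fin n, M.rankingData.v (σ k) * M.rankingData.w k := by
  simp only [rankingData_v, rankingData_w]
  exact Finset.sum_nonneg fun i _ => mul_nonneg (M.v_nonneg _)
    (mul_nonneg (M.weight_nonneg i) (M.q_nonneg i))

/-- For n = 0 the denominator would be an empty sum, hence zero. -/
theorem size_pos {n : ℕ} (M : Market n) : 0 < n := by
  by_contra h
  have : IsEmpty (Fin n) := ⟨fun i => h (Nat.zero_lt_of_lt i.2)⟩
  exact M.total_ne_zero 1 (Finset.sum_of_isEmpty _)

/-- The ranking of the songs that belongs to a multiplier. -/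
noncomputable def ranking (r : ℝ) : Equiv.Perm (Fin n) := M.rankingData.ranking r

theorem ranking_apply (r : ℝ) (k : Fin n) :
    (M.ranking r k : ℕ) = M.rankingData.position
      (rankOf n (fun i => M.rankingData.w i - r * M.rankingData.a i) M.rankingData.a k) :=
  M.rankingData.ranking_apply r k

theorem numer_eq (r : ℝ) : M.rankingData.numer r n =
    ∑ k : Fin n, M.rankingData.v (M.ranking r k) * M.rankingData.w k :=
  M.rankingData.numer_eq r

theorem denom_eq (r : ℝ) : M.rankingData.denom r n =
    ∑ k : Fin n, M.rankingData.v (M.ranking r k) * M.rankingData.a k :=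
  M.rankingData.denom_eq r

theorem expectedDownloads_ranking (r : ℝ) : M.expectedDownloads (M.ranking r) =
    M.rankingData.numer r n / M.rankingData.denom r n := by
  rw [expectedDownloads_eq, numer_eq, denom_eq]

/-- Here `b` is the stored best value: it dominates all breakpoints, hence every ranking, and the
stored multiplier `r` does at least as well. -/
theorem isPerformanceRanking_ranking {r b : ℝ}
    (hb : b ≤ M.rankingData.numer r n / M.rankingData.denom r n)
    (hbr : ∀ i < n, ∀ j < n, M.rankingData.numer (M.rankingData.breakpoint i j) n /
      M.rankingData.denom (M.rankingData.breakpoint i j) n ≤ b) :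
    M.IsPerformanceRanking (M.ranking r) := by
  intro τ
  obtain ⟨i, hi, j, hj, h⟩ := RankingData.exists_breakpoint_le (P := M.rankingData) M.size_pos
    M.denominator_pos M.numerator_nonneg τ
  rw [expectedDownloads_ranking, expectedDownloads_eq]
  exact h.trans ((hbr i hi j hj).trans hb)

theorem performanceRanking_runs :
    Runs (SizeBound R L n) N performanceRanking (State.ofInput M.input)
      (n * (n * (n * (n * 9 + 26) + 28) + 6) + n * (n * 9 + 26) + n * (n * 9 + 10) + n * 8 + 27)
      fun s' => ∃ σ : Equiv.Perm (Fin n),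
        M.IsPerformanceRanking σ ∧ ∀ i : Fin n, s'.idx 0 i = σ i := by
  set s := State.ofInput M.input with hs
  set P := M.rankingData with hP
  have hn : s.ivar 0 = n := by simp [hs, State.ofInput, input]
  have h1 : s.ivar 4 = 1 := by simp [hs, State.ofInput, input]
  have hden : ∀ r, P.denom r n ≠ 0 := fun r => by
    rw [hP, M.denom_eq r]
    exact (M.denominator_pos _).ne'
  refine .mono (.seq (.consequence (computeWeights_runs hn h1) le_rfl fun s₁ hag₁ _ hw =>
    .seq (.consequence (sortPositions_runs (P := P) ?_ ?_ ?_) le_rfl fun s₂ hag₂ _ hpos => ?_)))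
    (T := (((1 + (n * (n * 9 + 26) + 13)) + 1 +
      (n * (n * (n * (n * 9 + 26) + 28) + 6) + 3) + 1) + (n * (n * 9 + 10) + 3) + 1) +
        (n * 8 + 3) + 1) (by omega) fun _ h => h
  · rw [hag₁.ivar 0 (by decide), hn]; rfl
  · rw [hag₁.ivar 4 (by decide), h1]
  · rw [hag₁.num 3 (by decide)]; rfl
  have hL : Loaded P s₂ := {
    n := by rw [hag₂.ivar 0 (by decide), hag₁.ivar 0 (by decide), hn]; rfl
    one := by rw [hag₂.ivar 4 (by decide), hag₁.ivar 4 (by decide), h1]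
    v := fun i => by rw [hag₂.num 3 (by decide), hag₁.num 3 (by decide)]; rfl
    a := fun i hi => by rw [hag₂.num 5 (by decide)]; exact (hw i hi).1
    w := fun i hi => by rw [hag₂.num 6 (by decide)]; exact (hw i hi).2
    position := hpos }
  -- The stored value 0 need not be attained by any ranking; since all values are nonnegative, the
  -- inequality in `BestAttained` still holds.
  have hb : BestAttained P s₂ := by
    have h17 : s₂.num 17 0 = 0 := by
      rw [hag₂.num 17 (by decide), hag₁.num 17 (by decide)]; simp [hs, State.ofInput, input]
    rw [BestAttained, h17]
    change 0 ≤ M.rankingData.numer _ n / M.rankingData.denom _ n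
    rw [M.numer_eq, M.denom_eq]
    exact div_nonneg (M.numerator_nonneg _) (M.denominator_pos _).le
  -- The search leaves the ranking of the last breakpoint in the output array, so the ranking is
  -- recomputed from the best multiplier.
  refine .mono (.seq (.consequence (searchBreakpoints_runs hL hden hb) le_rfl
    fun s₃ hag₃ _ ⟨hb₃, hbr⟩ => .seq (.numCopy (fun h hR => ?_)
    (.mono (computeRanking_runs (P := P) ?_ (hden _)) le_rfl
      fun s₄ ⟨_, h0⟩ => ⟨M.ranking (s₃.num 18 0), ?_, fun i => ?_⟩))))
    (T := ((n * (n * 9 + 26) + 13) + 1 + 1) + (n * (n * (n * (n * 9 + 26) + 28) + 6) + 3) + 1)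
    (by omega) fun _ h => h
  · simpa [arrayBits, scalar] using h hR
  · exact (hL.of_agreeOff hag₃ (by decide) (by decide) (by decide)).of_agreeOff
      (AgreeOff.of_step (c := .numCopy (scalar 7) (scalar 18)) fun _ => rfl) (by decide)
      (by decide) (by decide)
  · exact M.isPerformanceRanking_ranking hb₃ hbr
  · rw [h0 i i.2]
    have h7 : (s₃.setNum (scalar 7) (s₃.getNum (scalar 18))).num 7 0 = s₃.num 18 0 := by
      simp [scalar, State.getNum, Addr.eval]
    rw [h7]
    exact (M.ranking_apply (s₃.num 18 0) i).symm

theorem dimension_input : dimension M.input = 4 * n + 1 := by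
  simp [dimension, input]; omega

theorem bounded_ofInput (h : R → ∀ a i, HasBits L ((State.ofInput M.input).num a i)) :
    (State.ofInput M.input).Bounded (SizeBound R L n) (n + 1) where
  num a i hR := by
    by_cases ha : a < 5
    · have := h hR a i
      interval_cases a <;> exact this
    · have : (State.ofInput M.input).num a i = 0 := by
        simp only [State.ofInput]
        rw [M.input.getD_eq_default _ (le_of_not_gt ha), List.getD_nil]
      rw [this]
      exact HasBits.zero
  idx a i := Nat.zero_le _
  ivar a := by
    by_cases ha : a < 5
    · interval_cases a <;> simp [State.ofInput, input]
    · simp only [State.ofInput]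
      rw [M.input.getD_eq_default _ (le_of_not_gt ha)]
      exact Nat.zero_le _

end Market

/-! ### Uniform size bounds and the final assembly -/

theorem arrayBits_le (L n a : ℕ) : arrayBits L n a ≤ n * (9 * L + 4) + 21 * L + 9 := by
  by_cases ha : a < 20
  · have h1 : n * (5 * L + 2) ≤ n * (9 * L + 4) := Nat.mul_le_mul_left _ (by omega)
    have h2 : n * (4 * L + 2) ≤ n * (9 * L + 4) := Nat.mul_le_mul_left _ (by omega)
    interval_cases a <;>
      simp only [arrayBits, List.getD_cons_succ, List.getD_cons_zero] <;> omega
  · rw [arrayBits, List.getD_eq_default _ _ (by simp; omega)]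
    exact Nat.zero_le _

theorem sizeLe_of_bounded {n : ℕ} {s : State} (hR : R) (hn : n + 1 ≤ L)
    (h : s.Bounded (SizeBound R L n) (n + 1)) :
    s.SizeLe (2 * (L * (9 * L + 4) + 21 * L + 9) + 4) := by
  have hsize : ∀ m ≤ n + 1, Nat.size m ≤ 2 * (L * (9 * L + 4) + 21 * L + 9) + 4 := fun m hm => by
    -- A crude bound suffices: the integers are at most n + 1 ≤ L themselves.
    have : Nat.size m ≤ m := Nat.size_le.2 Nat.lt_two_pow_self
    omega
  refine ⟨fun a i => ?_, fun a i => hsize _ (h.idx a i), fun x => hsize _ (h.ivar x)⟩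
  have hle : arrayBits L n a ≤ L * (9 * L + 4) + 21 * L + 9 := by
    have := Nat.mul_le_mul_right (9 * L + 4) (by omega : n ≤ L)
    have := arrayBits_le L n a
    omega
  obtain ⟨r, hr, hlen⟩ := ((h.num a i hR).mono hle).exists_ratLength_le
  exact ⟨r, hr, hlen⟩

end MusicLab

theorem mainTheorem1 :
    ArithRAM.ComputableInStronglyPolynomialTime
      (ι := Σ n : ℕ, MusicLab.Market n)
      (fun M => M.2.input)
      (fun M out => ∃ σ : Equiv.Perm (Fin M.1),
        M.2.IsPerformanceRanking σ ∧ ∀ i : Fin M.1, out i = (σ i : ℕ)) := by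
  classical
  open Polynomial in
  refine ⟨MusicLab.performanceRanking,
    X * (X * (X * (X * 9 + 26) + 28) + 6) + X * (X * 9 + 26) + X * (X * 9 + 10) + X * 8 + 27,
    2 * (X * (9 * X + 4) + 21 * X + 9) + 4, ?_⟩
  rintro ⟨n, M⟩
  -- Size bounds are claimed only for rational input. With this `R` a single run serves real and
  -- rational markets alike; for the others `L` is a dummy value.
  let R : Prop := ∃ J, M.input = ArithRAM.castInput J
  let L : ℕ := if h : R then ArithRAM.encodingLength h.choose else 0
  have hL : ∀ J, M.input = ArithRAM.castInput J → L = ArithRAM.encodingLength J := fun J hJ => by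
    have hR : R := ⟨J, hJ⟩
    simp only [L, dif_pos hR]
    rw [ArithRAM.castInput_injective (hR.choose_spec.symm.trans hJ)]
  have hbits : R → ∀ a i, ArithRAM.HasBits L ((ArithRAM.State.ofInput M.input).num a i) := by
    rintro ⟨J, hJ⟩ a i
    rw [hL J hJ, hJ]
    exact ArithRAM.hasBits_ofInput J a i
  have hbdd := M.bounded_ofInput hbits
  obtain ⟨t, ht, s', hrun, hsol⟩ := M.performanceRanking_runs hbdd
  have hfin := hrun.iterate_step []
  refine ⟨t, ht.trans ?_, ?_, ?_, fun J hJ t' ht' => ?_⟩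
  · have hn : n ≤ ArithRAM.dimension M.input := by rw [M.dimension_input]; omega
    simp only [Polynomial.eval_add, Polynomial.eval_mul, Polynomial.eval_X,
      Polynomial.eval_ofNat]
    gcongr
  · rw [ArithRAM.run, hfin]; rfl
  · rw [ArithRAM.run, hfin]; exact hsol
  · have hn : n + 1 ≤ L := by
      have := ArithRAM.dimension_castInput_le J
      rw [← hJ, ← hL J hJ, M.dimension_input] at this
      omega
    have := MusicLab.sizeLe_of_bounded ⟨J, hJ⟩ hn (hrun.invariant_iterate hbdd [] ht')
    simpa [← hL J hJ, ArithRAM.run] using this
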